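/- Let $n\ge 4$, and let $\mathcal K_n$ be the real vector space of symmetric arrays $(s_{ij})_{1\le i,j\le n}$ with $s_{ii}=0$ and $\sum_j s_{ij}=0$. Let $\mathcal M^{\#}_{0,n}=\mathcal M_{0,n}-D$ be the moduli space of $n$ distinct points on the Riemann sphere up to Möbius transformations, in the gauge $(\sigma_1,\sigma_{n-1},\sigma_n)=(0,1,\infty)$, with coordinates $\sigma_2,\dots,\sigma_{n-2}$. Put $$E_i(s,\sigma)=\sum_{j\ne i,\ j<n}\frac{s_{ij}}{\sigma_i-\sigma_j},\qquad i=2,\dots,n-2 .$$ Let $p$ and $q$ be the maps on $\mathcal K_n\times\mathcal M^{\#}_{0,n}$ given by $p(s,\sigma)=s$ and $q(s,\sigma)=(\tau,\sigma)$ with $\tau_i=E_i(s,\sigma)$. Let $\omega=\sum_{i=2}^{n-2}d\tau_i\wedge d\sigma_i$ and $\bar\delta^{n-3}(\tau)=\bigwedge_{i=2}^{n-2}\bar\delta(\tau_i)$, where $\bar\delta(z)=\frac1{2\pi i}\bar\partial\frac1z=\frac1{2i}\,\delta(\operatorname{Re}z)\,\delta(\operatorname{Im}z)\,d\bar z$.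 Let $U\subset\mathcal K_n$ be the generic locus: the set of $s$ such that $s_A:=\sum_{i,j\in A}s_{ij}\ne0$ for all $A\subset\{1,\dots,n\}$ with $2\le|A|\le n-2$, and such that the Jacobian $\det(\partial E_i/\partial\sigma_j)$ is nonzero at every solution $\sigma\in\mathcal M^{\#}_{0,n}$ of $E_2=\dots=E_{n-2}=0$. A half-integrand is a holomorphic top form $\mathcal I=f(s,\sigma)\,d\sigma_2\wedge\dots\wedge d\sigma_{n-2}$ on $\mathcal M^{\#}_{0,n}$, which may depend smoothly on $s\in U$: $f$ is smooth on $U\times\mathcal M^{\#}_{0,n}$ and holomorphic in $\sigma$. In particular every form in $\Omega^{n-3}_D\mathcal M_{0,n}$ (logarithmic singularities on $D$) is a half-integrand that does not depend on $s$. For $s\in U$ and $v_1,\dots,v_{n-3}\in\mathcal K_n$ define $$\Omega_{\mathcal I}(s)(v_1,\dots,v_{n-3})=\int_{p^{-1}(s)}q^*\big[\bar\delta^{n-3}(\tau)\wedge\omega^{n-3}\,\mathcal I\big](v_1,\dots,v_{n-3}),$$ where $\bar\delta^{n-3}(\tau)$ takes values in the dual of top forms on $\mathcal M_{0,n}$,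 so that in the coordinates $\sigma_i$ only the coefficient $f$ of $\mathcal I$ enters. The delta functions $\delta(\operatorname{Re}\tau_i)\delta(\operatorname{Im}\tau_i)$ are understood as limits for $\varepsilon\to0^+$ of $\varepsilon^{-2}\rho(\tau_i/\varepsilon)$ with $\rho\in C_c^\infty(\mathbb C)$ and $\int\rho=1$. The integrand is first multiplied by a cutoff $\chi\in C_c^\infty(\mathcal M^{\#}_{0,n})$ that equals $1$ near the solutions of $E=0$, that is, near the support of $q^*\bar\delta^{n-3}(\tau)$. **Lemma.** The set $U$ is open and stable under multiplication by nonzero real numbers. For every half-integrand $\mathcal I$: 1. For each $s\in U$ there is exactly one alternating $(n-3)$-form $\Omega_{\mathcal I}(s)$ on $\mathcal K_n$ to which the regularized integrals converge for all choices of $\rho$ and $\chi$, and $\Omega_{\mathcal I}$ is a smooth complex-valued $(n-3)$-form on $U$. 2. $\Upsilon\lrcorner\,\Omega_{\mathcal I}=0$ on $U$, where $\Upsilon=\sum_{i<j}s_{ij}\,\partial/\partial s_{ij}$ is the Euler vector field. 3. If $\mathcal I$ is homogeneous of degree $d\in\mathbb Z$ in $s$, that is, $f(cs,\sigma)=c^d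 f(s,\sigma)$ for all real $c\ne0$, then $\Omega_{\mathcal I}$ is homogeneous of degree $d$: its pullback under $s\mapsto cs$ is $c^d\,\Omega_{\mathcal I}$ for all real $c\ne0$. 4. If $d=0$, in particular if $\mathcal I$ does not depend on $s$ (for instance $\mathcal I\in\Omega^{n-3}_D\mathcal M_{0,n}$), then $\Omega_{\mathcal I}$ descends to the projectivized kinematic space: on the image of $U$ in $\mathbb P\mathcal K_n$ there is exactly one $(n-3)$-form whose pullback under $\mathcal K_n\setminus\{0\}\to\mathbb P\mathcal K_n$ is $\Omega_{\mathcal I}$ on $U$. -/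

import Mathlib

open MeasureTheory Filter
open scoped ContDiff Topology LinearAlgebra.Projectivization

noncomputable section

namespace CHY

/-! ### Kinematic space

Throughout `n = m + 3`; the particles `1, …, n` are labelled by `Fin n`, so that particle `1` is
`0`, particle `n - 1` is `n - 2` and particle `n` is `n - 1`. -/

/-- The kinematic space `𝒦_n`: real symmetric arrays `s_{ij}` with `s_{ii} = 0` and
`∑_j s_{ij} = 0` (momentum conservation). -/
def Kin (n : ℕ) : Submodule ℝ (Fin n → Fin n → ℝ) where
  carrier := {s | (∀ i j, s i j = s j i) ∧ (∀ i, s i i = 0) ∧ ∀ i, ∑ j, s i j = 0}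
  add_mem' := by
    rintro a b ⟨ha, ha', ha''⟩ ⟨hb, hb', hb''⟩
    refine ⟨fun i j => ?_, fun i => ?_, fun i => ?_⟩
    · simp [ha i j, hb i j]
    · simp [ha' i, hb' i]
    · simp [Finset.sum_add_distrib, ha'' i, hb'' i]
  zero_mem' := by simp
  smul_mem' := by
    rintro c a ⟨ha, ha', ha''⟩
    refine ⟨fun i j => ?_, fun i => ?_, fun i => ?_⟩
    · simp [ha i j]
    · simp [ha' i]
    · simp [← Finset.mul_sum, ha'' i]

/-- The Mandelstam variable `s_I = ∑_{i, j ∈ I} s_{ij}`. -/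
def mandelstam {n : ℕ} (s : Kin n) (A : Finset (Fin n)) : ℝ :=
  ∑ i ∈ A, ∑ j ∈ A, s.1 i j

/-- The Euler vector field `Υ = ∑_{i<j} s_{ij} ∂/∂s_{ij}` on `𝒦_n`. Tangent spaces of the vector
space `𝒦_n` are identified with `𝒦_n`, see `coe_eulerField` for the expression in coordinates. -/
def eulerField {n : ℕ} (s : Kin n) : Kin n := s

/-- The coordinate vector field `∂/∂s_{ij}`, `i < j`, on symmetric arrays with zero diagonal. -/
def coordField {n : ℕ} (i j : Fin n) : Fin n → Fin n → ℝ :=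
  fun k l => if (k = i ∧ l = j) ∨ (k = j ∧ l = i) then 1 else 0

theorem coe_eulerField {n : ℕ} (s : Kin n) :
    ((eulerField s : Kin n) : Fin n → Fin n → ℝ) =
      ∑ i, ∑ j ∈ Finset.Ioi i, s.1 i j • coordField i j := by
  obtain ⟨s, hs, hd, -⟩ := s
  funext k l
  have key : ∀ i j : Fin n, i < j → s i j * coordField i j k l =
      (if i = k then if j = l then s k l else 0 else 0) +
        (if i = l then if j = k then s k l else 0 else 0) := by
    intro i j hij
    have := hs k l
    unfold coordField
    grind
  simp only [eulerField, Finset.sum_apply, Pi.smul_apply, smul_eq_mul]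
  have h2 : ∀ i, ∑ j ∈ Finset.Ioi i, s i j * coordField i j k l =
      (if i = k then if i < l then s k l else 0 else 0) +
        (if i = l then if i < k then s k l else 0 else 0) := by
    intro i
    rw [Finset.sum_congr rfl (fun j hj => key i j (Finset.mem_Ioi.1 hj)), Finset.sum_add_distrib]
    congr 1
    · by_cases h : i = k <;> simp [h]
    · by_cases h : i = l <;> simp [h]
  rw [Finset.sum_congr rfl (fun i _ => h2 i), Finset.sum_add_distrib]
  simp only [Finset.sum_ite_eq', Finset.mem_univ, if_true]
  rcases lt_trichotomy k l with h | h | h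
  · simp [h, h.not_gt]
  · subst h; simp [hd]
  · simp [h, h.not_gt]

/-! ### The moduli space and the scattering equations, in the gauge `(σ_1, σ_{n-1}, σ_n) = (0, 1, ∞)` -/

/-- The positions `(σ_1, …, σ_{n-1}) = (0, σ_2, …, σ_{n-2}, 1)` of the punctures at finite
distance. -/
def punctures {m : ℕ} (σ : Fin m → ℂ) : Fin (m + 2) → ℂ :=
  Fin.cons 0 (Fin.snoc σ 1 : Fin (m + 1) → ℂ)

/-- The open moduli space `ℳ_{0,n} - D` of `n` distinct points on the Riemann sphere up to
Möbius transformations, in the standard gauge. -/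
def moduli (m : ℕ) : Set (Fin m → ℂ) := {σ | Function.Injective (punctures σ)}

/-- The index of `σ i` in `punctures σ`. -/
def movable {m : ℕ} (i : Fin m) : Fin (m + 2) := i.castSucc.succ

/-- `E_i(s, σ) = ∑_{j ≠ i} s_{ij} / (σ_i - σ_j)` for `i = 2, …, n - 2`. The puncture at infinity
does not contribute, and the term `j = i` is zero. -/
def scatteringMap {m : ℕ} (s : Kin (m + 3)) (σ : Fin m → ℂ) : Fin m → ℂ := fun i =>
  ∑ j : Fin (m + 2), (s.1 (movable i).castSucc j.castSucc : ℂ) /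
    (punctures σ (movable i) - punctures σ j)

/-- The solutions in `ℳ_{0,n} - D` of the scattering equations. -/
def solutions {m : ℕ} (s : Kin (m + 3)) : Set (Fin m → ℂ) :=
  {σ | σ ∈ moduli m ∧ scatteringMap s σ = 0}

/-- The generic kinematic points: off the factorization hyperplanes `s_I = 0`, and such that all
solutions of the scattering equations are nondegenerate. -/
def genericLocus (m : ℕ) : Set (Kin (m + 3)) :=
  {s | (∀ A : Finset (Fin (m + 3)), 2 ≤ A.card → A.card ≤ m + 1 → mandelstam s A ≠ 0) ∧
    ∀ σ ∈ solutions s, (fderiv ℂ (scatteringMap s) σ).det ≠ 0}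

/-! ### Forms on twistor space -/

/-- Twistor space `𝕋 = T^*_D ℳ_{0,n}` over the open moduli space: coordinates `(τ, σ)`, standing
for the covector `∑ τ_i dσ_i` at `σ`. -/
abbrev Twistor (m : ℕ) : Type := (Fin m → ℂ) × (Fin m → ℂ)

/-- The correspondence space `𝒴_n = 𝒦_n × ℳ_{0,n}`. -/
abbrev Corr (m : ℕ) : Type := Kin (m + 3) × (Fin m → ℂ)

/-- The wedge product of complex valued alternating forms. -/
def wedge {V : Type*} [AddCommGroup V] [Module ℝ V] {k l : ℕ}
    (a : V [⋀^Fin k]→ₗ[ℝ] ℂ) (b : V [⋀^Fin l]→ₗ[ℝ] ℂ) : V [⋀^Fin (k + l)]→ₗ[ℝ] ℂ :=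
  ((LinearMap.mul' ℝ ℂ).compAlternatingMap (a.domCoprod b)).domDomCongr finSumFinEquiv

/-- A linear functional as a 1-form. -/
def oneForm {V : Type*} [AddCommGroup V] [Module ℝ V] (f : V →ₗ[ℝ] ℂ) : V [⋀^Fin 1]→ₗ[ℝ] ℂ :=
  AlternatingMap.ofSubsingleton ℝ V ℂ 0 f

/-- `θ_1 ∧ ⋯ ∧ θ_k` for 1-forms `θ_i`. -/
def wedgeOneForms {V : Type*} [AddCommGroup V] [Module ℝ V] :
    (k : ℕ) → (Fin k → V →ₗ[ℝ] ℂ) → V [⋀^Fin k]→ₗ[ℝ] ℂ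
  | 0, _ => AlternatingMap.constOfIsEmpty ℝ V (Fin 0) 1
  | k + 1, θ => wedge (wedgeOneForms k fun i => θ i.castSucc) (oneForm (θ (Fin.last k)))

/-- The exterior power `β^k` of a 2-form. -/
def wedgePow {V : Type*} [AddCommGroup V] [Module ℝ V] (β : V [⋀^Fin 2]→ₗ[ℝ] ℂ) :
    (k : ℕ) → V [⋀^Fin (2 * k)]→ₗ[ℝ] ℂ
  | 0 => AlternatingMap.constOfIsEmpty ℝ V (Fin 0) 1
  | k + 1 => wedge (wedgePow β k) β

/-- The 1-form `dτ_i`. -/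
def dTau {m : ℕ} (i : Fin m) : Twistor m →ₗ[ℝ] ℂ :=
  LinearMap.proj i ∘ₗ LinearMap.fst ℝ (Fin m → ℂ) (Fin m → ℂ)

/-- The 1-form `dσ_i`. -/
def dSigma {m : ℕ} (i : Fin m) : Twistor m →ₗ[ℝ] ℂ :=
  LinearMap.proj i ∘ₗ LinearMap.snd ℝ (Fin m → ℂ) (Fin m → ℂ)

/-- The 1-form `dτ̄_i`. -/
def dTauBar {m : ℕ} (i : Fin m) : Twistor m →ₗ[ℝ] ℂ :=
  Complex.conjAe.toLinearMap ∘ₗ dTau i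

/-- The symplectic form `ω = ∑ dτ_i ∧ dσ_i`. -/
def symplecticForm (m : ℕ) : Twistor m [⋀^Fin 2]→ₗ[ℝ] ℂ :=
  ∑ i, wedge (oneForm (dTau i)) (oneForm (dSigma i))

/-- A mollifier on `ℂ`: the functions `ε⁻² ρ(z / ε)` tend to `δ(Re z) δ(Im z)` as `ε → 0`. -/
structure IsMollifier (ρ : ℂ → ℝ) : Prop where
  smooth : ContDiff ℝ ∞ ρ
  hasCompactSupport : HasCompactSupport ρ
  integral_eq_one : ∫ z, ρ z = 1

/-- The regularization `δ̄_ε(τ_1) ∧ ⋯ ∧ δ̄_ε(τ_{n-3})` at the point `x = (τ, σ)` of the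
`(0, n-3)`-form `δ̄^{n-3}(τ)`, where `δ̄(z) = (1 / 2πi) ∂̄(1/z) = (1 / 2i) δ(Re z) δ(Im z) dz̄` and
`δ(Re z) δ(Im z)` is replaced by the smooth function `ε⁻² ρ(z / ε)`. -/
def deltaBarForm {m : ℕ} (ρ : ℂ → ℝ) (ε : ℝ) (x : Twistor m) : Twistor m [⋀^Fin m]→ₗ[ℝ] ℂ :=
  wedgeOneForms m fun i =>
    ((1 / (2 * Complex.I)) * ((ε⁻¹ ^ 2 * ρ ((ε⁻¹ : ℂ) * x.1 i) : ℝ) : ℂ)) • dTauBar i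

/-- The map `q : 𝒴_n → 𝕋` given by the incidence relations `τ_i = E_i(s, σ)`. -/
def incidenceMap (m : ℕ) : Corr m → Twistor m := fun y => (scatteringMap y.1 y.2, y.2)

/-- `q^*[δ̄_ε^{n-3}(τ) ∧ ω^{n-3}]` at a point of `𝒴_n`. -/
def pulledBackForm {m : ℕ} (ρ : ℂ → ℝ) (ε : ℝ) (y : Corr m) :
    Corr m [⋀^Fin (m + 2 * m)]→ₗ[ℝ] ℂ :=
  (wedge (deltaBarForm ρ ε (incidenceMap m y)) (wedgePow (symplecticForm m) m)).compLinearMap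
    (fderiv ℝ (incidenceMap m) y).toLinearMap

/-! ### Half-integrands and scattering forms -/

/-- A CHY half-integrand: a holomorphic top form
`coeff s σ dσ_2 ∧ ⋯ ∧ dσ_{n-2}` on `ℳ_{0,n} - D`, possibly depending (smoothly) on the
generic kinematic point `s`; forms with logarithmic singularities on `D` are among the half-integrands
that do not depend on `s`. -/
structure HalfIntegrand (m : ℕ) where
  coeff : Kin (m + 3) → (Fin m → ℂ) → ℂ
  holomorphic : ∀ s ∈ genericLocus m, DifferentiableOn ℂ (coeff s) (moduli m)
  smooth : ContDiffOn ℝ ∞ (Function.uncurry coeff) (genericLocus m ×ˢ moduli m)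

/-- `I` is homogeneous of degree `d` in the kinematic variables; `d = 0` if `I` does not depend
on them. -/
def HalfIntegrand.IsHomogeneous {m : ℕ} (I : HalfIntegrand m) (d : ℤ) : Prop :=
  ∀ s ∈ genericLocus m, ∀ c : ℝ, c ≠ 0 → ∀ σ ∈ moduli m,
    I.coeff (c • s) σ = ((c ^ d : ℝ) : ℂ) * I.coeff s σ

/-- The oriented real basis `(e_1, i e_1, e_2, i e_2, …)` of the fibre directions `ℂ^{n-3}`. -/
def fibreBasis (m : ℕ) (l : Fin (2 * m)) : Fin m → ℂ :=
  Pi.single ⟨l.1 / 2, by omega⟩ (if l.1 % 2 = 0 then 1 else Complex.I)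

/-- Evaluation of a form on `𝒴_n` at the horizontal lifts of `v_1, …, v_{n-3}`, followed by the
oriented basis of the fibre of `p : 𝒴_n → 𝒦_n`. -/
def fibreCoefficient {m : ℕ} (Θ : Corr m [⋀^Fin (m + 2 * m)]→ₗ[ℝ] ℂ)
    (v : Fin m → Kin (m + 3)) : ℂ :=
  Θ (Fin.append (fun j => ((v j, 0) : Corr m)) (fun l => ((0, fibreBasis m l) : Corr m)))

/-- The integral over the fibre `p⁻¹(s)` of `χ q^*[δ̄_ε^{n-3}(τ) ∧ ω^{n-3} I]`, evaluated on the
tangent vectors `v_1, …, v_{n-3}` at `s`. The form `δ̄^{n-3}(τ)` takes values in the dual of the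
top forms on `ℳ_{0,n}`, so that only the coefficient of `I` remains in the coordinates `σ_i`. -/
def regularizedIntegral {m : ℕ} (I : HalfIntegrand m) (ρ : ℂ → ℝ) (χ : (Fin m → ℂ) → ℝ) (ε : ℝ)
    (s : Kin (m + 3)) (v : Fin m → Kin (m + 3)) : ℂ :=
  ∫ σ in moduli m, (χ σ : ℂ) * (I.coeff s σ * fibreCoefficient (pulledBackForm ρ ε (s, σ)) v)

/-- A test function on `ℳ_{0,n} - D` that is `1` near the solutions of the scattering equations,
that is, near the support of `q^* δ̄^{n-3}(τ)` on the fibre over `s`. -/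
structure IsCutoff {m : ℕ} (s : Kin (m + 3)) (χ : (Fin m → ℂ) → ℝ) : Prop where
  smooth : ContDiff ℝ ∞ χ
  hasCompactSupport : HasCompactSupport χ
  tsupport_subset : tsupport χ ⊆ moduli m
  eventually_eq_one : ∀ σ ∈ solutions s, ∀ᶠ σ' in 𝓝 σ, χ σ' = 1

/-- `Ω` is the value at `s` of `∫_{p⁻¹(s)} q^*[δ̄^{n-3}(τ) ∧ ω^{n-3} I]`: the delta functions are
the limits of their regularizations, for any mollifier, and the resulting compactly supported
distribution on the fibre is integrated with the help of any cutoff. -/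
def IsFibreIntegral {m : ℕ} (I : HalfIntegrand m) (s : Kin (m + 3))
    (Ω : Kin (m + 3) [⋀^Fin m]→ₗ[ℝ] ℂ) : Prop :=
  ∀ ρ χ, IsMollifier ρ → IsCutoff s χ → ∀ v,
    Tendsto (fun ε => regularizedIntegral I ρ χ ε s v) (𝓝[>] 0) (𝓝 (Ω v))

open Classical in
/-- The scattering form `Ω_I = ∫_{p⁻¹(s)} q^*[δ̄^{n-3}(τ) ∧ ω^{n-3} I]`, an `(n-3)`-form on
(the generic part of) `𝒦_n`. -/
def scatteringForm {m : ℕ} (I : HalfIntegrand m) (s : Kin (m + 3)) :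
    Kin (m + 3) [⋀^Fin m]→ₗ[ℝ] ℂ :=
  if h : ∃ Ω, IsFibreIntegral I s Ω then h.choose else 0

/-! ### Projectivized kinematic space -/

/-- The tangent space `Hom(ℓ, V / ℓ)` of the projective space of `V` at the line `ℓ`. -/
abbrev ProjTangent {V : Type*} [AddCommGroup V] [Module ℝ V] (p : ℙ ℝ V) : Type _ :=
  p.submodule →ₗ[ℝ] V ⧸ p.submodule

/-- The differential at `s` of the projection `V - 0 → ℙ V`: it sends `v` to the homomorphism
with `s ↦ v mod s`. -/
def projDeriv {V : Type*} [AddCommGroup V] [Module ℝ V] (s : V) (hs : s ≠ 0) :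
    V →ₗ[ℝ] ProjTangent (Projectivization.mk ℝ s hs) :=
  LinearMap.smulRightₗ (LinearEquiv.toSpanNonzeroSingleton ℝ V s hs).symm.toLinearMap ∘ₗ
    (Projectivization.mk ℝ s hs).submodule.mkQ

/-- The generic part of the projectivized kinematic space `ℙ𝒦_n`. -/
def projGenericLocus (m : ℕ) : Set (ℙ ℝ (Kin (m + 3))) :=
  {p | ∃ (s : Kin (m + 3)) (hs : s ≠ 0), s ∈ genericLocus m ∧ Projectivization.mk ℝ s hs = p}

end CHY

end

open CHY

/-!
The scattering form localizes on the solutions of the scattering equations. Up to its delta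
functions, `δ̄^{n-3}(τ) ∧ ω^{n-3}` is a constant form `β` on twistor space (`twistorForm`), so the
regularized integrand is `χ f · ∏ ε⁻² ρ(E_i / ε)` times the coefficient of `q^*β` along the fibre
(`residueForm`).
Near a nondegenerate solution the substitution `τ = E(s, σ)` turns the product of mollifiers into an
approximate identity, and away from the solutions the integrand vanishes for small `ε`
(`tendsto_integral_rescale_comp`). Hence the limit exists and equals
`∑ f(s, σ) / |det_ℝ ∂E/∂σ| · q^*β`, summed over the solutions `σ`
(`isFibreIntegral_solutionSum`). It is not necessary to evaluate `q^*β` any further.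

What is asserted about the form can be read off from this sum.

* Openness of the generic locus and smoothness of the form need that solutions do not escape to the
  boundary of the moduli space as `s` varies (`exists_tendsto_solution`). If in a limit a set `A` of
  punctures comes together at a finite point, the sum over `i ∈ A` of the equations
  `(σ_i - σ_a) E_i = 0` tends to `s_A / 2 = 0`, because the terms with both punctures in `A` can be
  symmetrized and the others tend to zero; if some punctures run off to infinity, the same works for
  `σ_i E_i = 0` and the set `A` that includes the puncture at infinity. Both are excluded by
  `s_A ≠ 0`. Given this, the implicit function theorem shows that the solutions over nearby points
  form finitely many smooth branches (`contDiffAt_sum_solutions`).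
* `E` is linear in `s`, so `dq` sends the lift of the Euler vector field to `∑ E_i ∂/∂τ_i`, which is
  zero at solutions; every summand is thus annihilated.
* For the same reason `s ↦ c s` is covered by the dilation `τ ↦ c τ`, which multiplies `β` by
  `c^{2(n-3)}`. The real Jacobian receives the same factor, and only the degree of `f` remains
  (`scatteringForm_smul`).
* A form that is annihilated by the Euler vector field and invariant under dilations descends to the
  projective space (`existsUnique_form_projectivization`).
-/

namespace CHY

/-! ### Punctures and the scattering map -/

theorem punctures_movable {m : ℕ} (σ : Fin m → ℂ) (i : Fin m) :
    punctures σ (movable i) = σ i := by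
  simp [punctures, movable]

theorem punctures_zero {m : ℕ} (σ : Fin m → ℂ) : punctures σ 0 = 0 := rfl

theorem punctures_last {m : ℕ} (σ : Fin m → ℂ) : punctures σ (Fin.last (m + 1)) = 1 := by
  rw [← Fin.succ_last]
  simp [punctures, -Fin.succ_last]

theorem eq_zero_or_eq_last_or_eq_movable {m : ℕ} (j : Fin (m + 2)) :
    j = 0 ∨ j = Fin.last (m + 1) ∨ ∃ i : Fin m, j = movable i := by
  refine Fin.cases (Or.inl rfl) (fun j => Or.inr ?_) j
  refine Fin.lastCases (Or.inl (Fin.succ_last _)) (fun i => Or.inr ⟨i, rfl⟩) j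

theorem contDiff_punctures {m : ℕ} (j : Fin (m + 2)) :
    ContDiff ℂ ∞ fun σ : Fin m → ℂ => punctures σ j := by
  rcases eq_zero_or_eq_last_or_eq_movable j with rfl | rfl | ⟨i, rfl⟩
  · simp only [punctures_zero]; fun_prop
  · simp only [punctures_last]; fun_prop
  · simp only [punctures_movable]; fun_prop

theorem isOpen_moduli (m : ℕ) : IsOpen (moduli m) := by
  have h : moduli m = ⋂ i, ⋂ j, ⋂ (_ : i ≠ j), {σ | punctures σ i ≠ punctures σ j} := by
    ext σ
    simp only [moduli, Set.mem_ofPred_eq, Set.mem_iInter, Function.Injective]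
    exact ⟨fun h i j hij e => hij (h e), fun h i j e => by_contra fun hij => h i j hij e⟩
  rw [h]
  refine isOpen_iInter_of_finite fun i => isOpen_iInter_of_finite fun j =>
    isOpen_iInter_of_finite fun _ => ?_
  exact isOpen_ne_fun (contDiff_punctures i).continuous (contDiff_punctures j).continuous

/-- The diagonal term of the scattering map, which is divided by zero, drops out because of
`s_{ii} = 0`; the other denominators do not vanish on the moduli space. -/
theorem kin_eq_zero_or_punctures_sub_ne_zero {m : ℕ} {σ : Fin m → ℂ} (hσ : σ ∈ moduli m)
    (i j : Fin (m + 2)) :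
    (∀ s : Kin (m + 3), s.1 i.castSucc j.castSucc = 0) ∨ punctures σ i - punctures σ j ≠ 0 := by
  by_cases h : i = j
  · subst h
    exact Or.inl fun s => s.2.2.1 _
  · exact Or.inr (sub_ne_zero.2 fun e => h (hσ e))

theorem contDiffAt_scatteringMap {m : ℕ} {s : Kin (m + 3)} {σ : Fin m → ℂ} (hσ : σ ∈ moduli m) :
    ContDiffAt ℝ ∞ (fun y : Corr m => scatteringMap y.1 y.2) (s, σ) := by
  refine contDiffAt_pi.2 fun i => ?_
  refine ContDiffAt.sum fun j _ => ?_
  rcases kin_eq_zero_or_punctures_sub_ne_zero hσ (movable i) j with h | h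
  · simp only [h, Complex.ofReal_zero, zero_div]
    exact contDiffAt_const
  · have hs : ContDiff ℝ ∞ fun y : Corr m => (y.1.1 (movable i).castSucc j.castSucc : ℂ) := by
      have h1 : ContDiff ℝ ∞ fun y : Corr m => y.1.1 (movable i).castSucc j.castSucc :=
        (contDiff_apply_apply ℝ ℝ _ _).comp ((Kin (m + 3)).subtypeL.contDiff.comp contDiff_fst)
      exact Complex.ofRealCLM.contDiff.comp h1
    have hp : ∀ k, ContDiff ℝ ∞ fun y : Corr m => punctures y.2 k := fun k =>
      ((contDiff_punctures k).restrict_scalars ℝ).comp contDiff_snd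
    simp only [div_eq_mul_inv]
    exact hs.contDiffAt.mul (((hp _).sub (hp j)).contDiffAt.inv h)

theorem differentiableAt_scatteringMap {m : ℕ} (s : Kin (m + 3)) {σ : Fin m → ℂ}
    (hσ : σ ∈ moduli m) : DifferentiableAt ℂ (scatteringMap s) σ := by
  refine differentiableAt_pi.2 fun i => ?_
  refine DifferentiableAt.fun_sum fun j _ => ?_
  rcases kin_eq_zero_or_punctures_sub_ne_zero hσ (movable i) j with h | h
  · simp only [h, Complex.ofReal_zero, zero_div]
    exact differentiableAt_const _
  · have hp : ∀ k, Differentiable ℂ fun σ : Fin m → ℂ => punctures σ k := fun k =>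
      (contDiff_punctures k).differentiable (by simp)
    simp only [div_eq_mul_inv]
    exact (differentiableAt_const _).mul (((hp _).sub (hp j)).differentiableAt.inv h)

theorem contDiffAt_scatteringMap_right {m : ℕ} (s : Kin (m + 3)) {σ : Fin m → ℂ}
    (hσ : σ ∈ moduli m) : ContDiffAt ℝ ∞ (scatteringMap s) σ :=
  (contDiffAt_scatteringMap (s := s) hσ).comp σ (contDiffAt_const.prodMk contDiffAt_id)

theorem scatteringMap_smul {m : ℕ} (c : ℝ) (s : Kin (m + 3)) (σ : Fin m → ℂ) :
    scatteringMap (c • s) σ = c • scatteringMap s σ := by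
  funext i
  simp [scatteringMap, Finset.mul_sum, mul_div_assoc]

theorem solutions_smul {m : ℕ} {c : ℝ} (hc : c ≠ 0) (s : Kin (m + 3)) :
    solutions (c • s) = solutions s := by
  ext σ
  simp [solutions, scatteringMap_smul, hc]

theorem mandelstam_smul {n : ℕ} (c : ℝ) (s : Kin n) (A : Finset (Fin n)) :
    mandelstam (c • s) A = c * mandelstam s A := by
  simp [mandelstam, Finset.mul_sum]

theorem continuous_mandelstam {n : ℕ} (A : Finset (Fin n)) :
    Continuous fun s : Kin n => mandelstam s A := by
  unfold mandelstam
  refine continuous_finsetSum _ fun i _ => continuous_finsetSum _ fun j _ => ?_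
  exact (continuous_apply_apply i j).comp continuous_subtype_val

theorem smul_mem_genericLocus {m : ℕ} {s : Kin (m + 3)} (hs : s ∈ genericLocus m) {c : ℝ}
    (hc : c ≠ 0) : c • s ∈ genericLocus m := by
  refine ⟨fun A h2 h3 => ?_, fun σ hσ => ?_⟩
  · rw [mandelstam_smul]
    exact mul_ne_zero hc (hs.1 A h2 h3)
  · rw [solutions_smul hc] at hσ
    have h : scatteringMap (c • s) = (c : ℂ) • scatteringMap s := by
      funext σ
      rw [scatteringMap_smul]
      rfl
    rw [h, fderiv_const_smul (differentiableAt_scatteringMap s hσ.1)]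
    have := hs.2 σ hσ
    rw [ContinuousLinearMap.det] at this ⊢
    rw [ContinuousLinearMap.toLinearMap_smul, LinearMap.det_smul]
    exact mul_ne_zero (pow_ne_zero _ (by exact_mod_cast hc)) this

/-- The Jacobian of the scattering equations with respect to the `2 (n - 3)` real coordinates of
the fibre. -/
noncomputable def realJacobian {m : ℕ} (s : Kin (m + 3)) (σ : Fin m → ℂ) : ℝ :=
  (fderiv ℝ (scatteringMap s) σ).det

theorem realJacobian_eq {m : ℕ} (s : Kin (m + 3)) {σ : Fin m → ℂ} (hσ : σ ∈ moduli m) :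
    realJacobian s σ = Complex.normSq (fderiv ℂ (scatteringMap s) σ).det := by
  have h := (differentiableAt_scatteringMap s hσ).hasFDerivAt.restrictScalars ℝ
  rw [realJacobian, h.fderiv, ContinuousLinearMap.det, ← Algebra.norm_complex_apply,
    ContinuousLinearMap.det]
  exact LinearMap.det_restrictScalars

theorem realJacobian_ne_zero_iff {m : ℕ} (s : Kin (m + 3)) {σ : Fin m → ℂ} (hσ : σ ∈ moduli m) :
    realJacobian s σ ≠ 0 ↔ (fderiv ℂ (scatteringMap s) σ).det ≠ 0 := by
  rw [realJacobian_eq s hσ, Ne, Complex.normSq_eq_zero]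

theorem fderiv_scatteringMap_eq {m : ℕ} (s : Kin (m + 3)) {σ : Fin m → ℂ} (hσ : σ ∈ moduli m) :
    fderiv ℝ (scatteringMap s) σ =
      (fderiv ℝ (fun y : Corr m => scatteringMap y.1 y.2) (s, σ)).comp
        (ContinuousLinearMap.inr ℝ (Kin (m + 3)) (Fin m → ℂ)) := by
  have h := ((contDiffAt_scatteringMap (s := s) hσ).differentiableAt (by simp)).hasFDerivAt
  exact (h.comp σ (hasFDerivAt_prodMk_right s σ)).fderiv

theorem contDiffAt_realJacobian {m : ℕ} {s : Kin (m + 3)} {σ : Fin m → ℂ} (hσ : σ ∈ moduli m) :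
    ContDiffAt ℝ ∞ (fun y : Corr m => realJacobian y.1 y.2) (s, σ) := by
  have h1 : ContDiffAt ℝ ∞ (fderiv ℝ fun y : Corr m => scatteringMap y.1 y.2) (s, σ) :=
    (contDiffAt_scatteringMap hσ).fderiv_right (by simp)
  have h2 : ContDiffAt ℝ ∞ (fun y : Corr m =>
      ((fderiv ℝ (fun y : Corr m => scatteringMap y.1 y.2) y).comp
        (ContinuousLinearMap.inr ℝ (Kin (m + 3)) (Fin m → ℂ))).det) (s, σ) := by
    let b := Module.finBasis ℝ (Fin m → ℂ)
    have h3 : ∀ f : (Fin m → ℂ) →L[ℝ] (Fin m → ℂ), f.det =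
        ∑ π : Equiv.Perm (Fin (Module.finrank ℝ (Fin m → ℂ))),
          (Equiv.Perm.sign π : ℝ) *
            ∏ i, LinearMap.toContinuousLinearMap (b.coord (π i)) (f (b i)) := by
      intro f
      rw [ContinuousLinearMap.det, ← LinearMap.det_toMatrix b, Matrix.det_apply']
      simp [LinearMap.toMatrix_apply]
    simp only [h3]
    refine ContDiffAt.sum fun π _ => contDiffAt_const.mul (contDiffAt_prod fun i _ => ?_)
    refine (ContinuousLinearMap.contDiff _).contDiffAt.comp _ ?_
    exact (h1.clm_comp contDiffAt_const).clm_apply contDiffAt_const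
  refine h2.congr_of_eventuallyEq ?_
  have : ∀ᶠ y : Corr m in 𝓝 (s, σ), y.2 ∈ moduli m :=
    continuousAt_snd ((isOpen_moduli m).mem_nhds hσ)
  filter_upwards [this] with y hy
  rw [realJacobian, fderiv_scatteringMap_eq y.1 hy]


/-! ### Properness of the space of solutions -/

theorem sum_mul_div_sub_eq_half_sum {ι : Type*} (A : Finset ι) {t : ι → ι → ℂ}
    (ht : ∀ i j, t i j = t j i) (ht' : ∀ i, t i i = 0) {x : ι → ℂ} (hx : Function.Injective x)
    (w : ℂ) :
    ∑ i ∈ A, ∑ j ∈ A, t i j * ((x i - w) / (x i - x j)) = 1 / 2 * ∑ i ∈ A, ∑ j ∈ A, t i j := by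
  have h1 : ∑ i ∈ A, ∑ j ∈ A, t i j * ((x i - w) / (x i - x j)) =
      ∑ i ∈ A, ∑ j ∈ A, t j i * ((x j - w) / (x j - x i)) := Finset.sum_comm
  have h2 : ∑ i ∈ A, ∑ j ∈ A, t i j * ((x i - w) / (x i - x j)) +
      ∑ i ∈ A, ∑ j ∈ A, t j i * ((x j - w) / (x j - x i)) = ∑ i ∈ A, ∑ j ∈ A, t i j := by
    simp only [← Finset.sum_add_distrib]
    refine Finset.sum_congr rfl fun i _ => Finset.sum_congr rfl fun j _ => ?_
    by_cases hij : i = j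
    · subst hij; simp [ht']
    · have h3 : x i - x j ≠ 0 := sub_ne_zero.2 fun e => hij (hx e)
      have h4 : x j - x i ≠ 0 := sub_ne_zero.2 fun e => hij (hx e.symm)
      rw [ht j i]
      field_simp
      ring
  rw [← h1] at h2
  linear_combination (1 / 2) * h2

/-- The sum `∑_{i ∈ A} (σ_i - w) E_i` of scattering equations over a set `A` of punctures: the terms
with both punctures in `A` add up to half the sum of their Mandelstam variables. -/
theorem half_sum_add_sum_compl_eq_zero {m : ℕ} {s : Kin (m + 3)} {σ : Fin m → ℂ}
    (h : σ ∈ solutions s) (A : Finset (Fin (m + 2))) (w : ℂ)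
    (hA : ∀ i ∈ A, (∃ k, i = movable k) ∨ punctures σ i = w) :
    1 / 2 * ∑ i ∈ A, ∑ j ∈ A, (s.1 i.castSucc j.castSucc : ℂ) +
      ∑ i ∈ A, ∑ j ∈ Aᶜ, (s.1 i.castSucc j.castSucc : ℂ) *
        ((punctures σ i - w) / (punctures σ i - punctures σ j)) = 0 := by
  rw [← sum_mul_div_sub_eq_half_sum A (fun i j => by rw [s.2.1]) (fun i => by simp [s.2.2.1])
    h.1 w, ← Finset.sum_add_distrib]
  refine Finset.sum_eq_zero fun i hi => ?_
  rw [Finset.sum_add_sum_compl]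
  have : ∀ j, (s.1 i.castSucc j.castSucc : ℂ) *
      ((punctures σ i - w) / (punctures σ i - punctures σ j)) =
      (punctures σ i - w) *
        ((s.1 i.castSucc j.castSucc : ℂ) / (punctures σ i - punctures σ j)) := fun j => by ring
  simp only [this, ← Finset.mul_sum]
  rcases hA i hi with ⟨k, rfl⟩ | h0
  · exact mul_eq_zero_of_right _ (congrFun h.2 k)
  · rw [h0, sub_self, zero_mul]

theorem mandelstam_map_castSucc {n : ℕ} (s : Kin (n + 1)) (A : Finset (Fin n)) :
    mandelstam s (A.map Fin.castSuccEmb) = ∑ i ∈ A, ∑ j ∈ A, s.1 i.castSucc j.castSucc := by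
  simp [mandelstam]

theorem mandelstam_cons_last {n : ℕ} (s : Kin (n + 1)) (A : Finset (Fin n)) :
    mandelstam s (Finset.cons (Fin.last n) (A.map Fin.castSuccEmb) (by simp)) =
      -∑ i ∈ A, ∑ j ∈ A, s.1 i.castSucc j.castSucc
        - 2 * ∑ i ∈ A, ∑ j ∈ Aᶜ, s.1 i.castSucc j.castSucc := by
  have h1 : ∑ i ∈ A, (∑ j ∈ A, s.1 i.castSucc j.castSucc + ∑ j ∈ Aᶜ, s.1 i.castSucc j.castSucc +
      s.1 i.castSucc (Fin.last n)) = 0 := by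
    refine Finset.sum_eq_zero fun i _ => ?_
    rw [Finset.sum_add_sum_compl, ← Fin.sum_univ_castSucc]
    exact s.2.2.2 _
  rw [Finset.sum_add_distrib, Finset.sum_add_distrib] at h1
  simp only [mandelstam, Finset.sum_cons, Finset.sum_map, Fin.castSuccEmb_apply,
    Finset.sum_add_distrib, s.2.2.1, s.2.1 (Fin.last n)]
  linear_combination 2 * h1

theorem tendsto_or_tendsto_cobounded {α E : Type*} [NormedAddCommGroup E] [ProperSpace E]
    (F : Ultrafilter α) (f : α → E) :
    (∃ z, Tendsto f F (𝓝 z)) ∨ Tendsto f F (Bornology.cobounded E) := by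
  by_cases h : Tendsto f F (Bornology.cobounded E)
  · exact Or.inr h
  rw [← tendsto_norm_atTop_iff_cobounded, tendsto_atTop] at h
  push Not at h
  obtain ⟨R, hR⟩ := h
  have h3 : ((F.map f : Ultrafilter E) : Filter E) ≤ 𝓟 (Metric.closedBall 0 R) := by
    rw [le_principal_iff]
    refine Ultrafilter.mem_map.2 (hR.mono fun y hy => ?_)
    simpa using hy.le
  obtain ⟨z, -, hz⟩ := (isCompact_closedBall (0 : E) R).ultrafilter_le_nhds _ h3
  exact Or.inl ⟨z, hz⟩

theorem tendsto_coe_kin {m : ℕ} {F : Filter (Corr m)} {s : Kin (m + 3)}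
    (h : Tendsto Prod.fst F (𝓝 s)) (i j : Fin (m + 3)) :
    Tendsto (fun y : Corr m => (y.1.1 i j : ℂ)) F (𝓝 (s.1 i j)) := by
  have : Continuous fun s : Kin (m + 3) => (s.1 i j : ℂ) :=
    Complex.continuous_ofReal.comp ((continuous_apply_apply i j).comp continuous_subtype_val)
  exact (this.tendsto s).comp h

/-- If a set `A` of punctures runs off to infinity and the others converge, then the Mandelstam
variable of `A` together with the puncture at infinity vanishes in the limit. -/
theorem mandelstam_eq_zero_of_tendsto_cobounded {m : ℕ} {F : Filter (Corr m)} [F.NeBot]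
    {s : Kin (m + 3)} (hs : Tendsto Prod.fst F (𝓝 s)) (hF : ∀ᶠ y in F, y.2 ∈ solutions y.1)
    (A : Finset (Fin (m + 2)))
    (hA : ∀ i ∈ A, Tendsto (fun y : Corr m => punctures y.2 i) F (Bornology.cobounded ℂ))
    (z : Fin (m + 2) → ℂ)
    (hz : ∀ i ∉ A, Tendsto (fun y : Corr m => punctures y.2 i) F (𝓝 (z i)))
    (hA' : ∀ i ∈ A, ∃ k, i = movable k) :
    mandelstam s (Finset.cons (Fin.last (m + 2)) (A.map Fin.castSuccEmb) (by simp)) = 0 := by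
  have hlim : Tendsto (fun y : Corr m =>
      1 / 2 * ∑ i ∈ A, ∑ j ∈ A, (y.1.1 i.castSucc j.castSucc : ℂ) +
      ∑ i ∈ A, ∑ j ∈ Aᶜ, (y.1.1 i.castSucc j.castSucc : ℂ) *
        ((punctures y.2 i - 0) / (punctures y.2 i - punctures y.2 j))) F
      (𝓝 (1 / 2 * ∑ i ∈ A, ∑ j ∈ A, (s.1 i.castSucc j.castSucc : ℂ) +
      ∑ i ∈ A, ∑ j ∈ Aᶜ, (s.1 i.castSucc j.castSucc : ℂ) * 1)) := by
    refine Tendsto.add (Tendsto.const_mul _ (tendsto_finsetSum _ fun i _ =>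
      tendsto_finsetSum _ fun j _ => tendsto_coe_kin hs _ _)) ?_
    refine tendsto_finsetSum _ fun i hi => tendsto_finsetSum _ fun j hj =>
      (tendsto_coe_kin hs _ _).mul ?_
    have h1 := tendsto_inv₀_cobounded.comp (hA i hi)
    have h2 := (hz j (by simpa using hj)).mul h1
    have h3 : Tendsto (fun y : Corr m => (1 - punctures y.2 j * (punctures y.2 i)⁻¹)⁻¹) F
        (𝓝 (1 - z j * 0)⁻¹) := (h2.const_sub 1).inv₀ (by simp)
    rw [mul_zero, sub_zero, inv_one] at h3
    refine h3.congr' ?_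
    filter_upwards [(hA i hi).eventually_ne_cobounded 0] with y hy
    rw [sub_zero, ← div_eq_mul_inv, one_sub_div hy, inv_div]
  have h0 : 1 / 2 * ∑ i ∈ A, ∑ j ∈ A, (s.1 i.castSucc j.castSucc : ℂ) +
      ∑ i ∈ A, ∑ j ∈ Aᶜ, (s.1 i.castSucc j.castSucc : ℂ) * 1 = 0 := by
    refine tendsto_nhds_unique hlim (tendsto_const_nhds.congr' ?_)
    filter_upwards [hF] with y hy
    exact (half_sum_add_sum_compl_eq_zero hy A 0 fun i hi => Or.inl (hA' i hi)).symm
  simp only [mul_one] at h0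
  have h4 : 1 / 2 * ∑ i ∈ A, ∑ j ∈ A, s.1 i.castSucc j.castSucc +
      ∑ i ∈ A, ∑ j ∈ Aᶜ, s.1 i.castSucc j.castSucc = 0 :=
    Complex.ofReal_injective (by push_cast; exact h0)
  rw [mandelstam_cons_last]
  linear_combination (-2) * h4

/-- If all punctures converge in `ℂ`, then the Mandelstam variable of those with limit `c` vanishes
in the limit, provided that at most one of them, number `a`, is gauge fixed. -/
theorem mandelstam_eq_zero_of_tendsto {m : ℕ} {F : Filter (Corr m)} [F.NeBot]
    {s : Kin (m + 3)} (hs : Tendsto Prod.fst F (𝓝 s)) (hF : ∀ᶠ y in F, y.2 ∈ solutions y.1)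
    (z : Fin (m + 2) → ℂ)
    (hz : ∀ i, Tendsto (fun y : Corr m => punctures y.2 i) F (𝓝 (z i)))
    (A : Finset (Fin (m + 2))) (a : Fin (m + 2)) (hA : ∀ i, i ∈ A ↔ z i = z a)
    (hA' : ∀ i ∈ A, (∃ k, i = movable k) ∨ i = a) :
    mandelstam s (A.map Fin.castSuccEmb) = 0 := by
  have hlim : Tendsto (fun y : Corr m =>
      1 / 2 * ∑ i ∈ A, ∑ j ∈ A, (y.1.1 i.castSucc j.castSucc : ℂ) +
      ∑ i ∈ A, ∑ j ∈ Aᶜ, (y.1.1 i.castSucc j.castSucc : ℂ) *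
        ((punctures y.2 i - punctures y.2 a) / (punctures y.2 i - punctures y.2 j))) F
      (𝓝 (1 / 2 * ∑ i ∈ A, ∑ j ∈ A, (s.1 i.castSucc j.castSucc : ℂ) +
      ∑ i ∈ A, ∑ j ∈ Aᶜ, (s.1 i.castSucc j.castSucc : ℂ) * ((z i - z a) / (z i - z j)))) := by
    refine Tendsto.add (Tendsto.const_mul _ (tendsto_finsetSum _ fun i _ =>
      tendsto_finsetSum _ fun j _ => tendsto_coe_kin hs _ _)) ?_
    refine tendsto_finsetSum _ fun i hi => tendsto_finsetSum _ fun j hj =>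
      (tendsto_coe_kin hs _ _).mul (((hz i).sub (hz a)).div ((hz i).sub (hz j)) ?_)
    rw [Finset.mem_compl, hA] at hj
    rw [(hA i).1 hi, sub_ne_zero]
    exact Ne.symm hj
  have h0 := tendsto_nhds_unique hlim (tendsto_const_nhds.congr' (by
    filter_upwards [hF] with y hy
    refine (half_sum_add_sum_compl_eq_zero hy A _ fun i hi => ?_).symm
    exact (hA' i hi).imp_right fun h => by rw [h]))
  have h1 : ∑ i ∈ A, ∑ j ∈ Aᶜ, (s.1 i.castSucc j.castSucc : ℂ) *
      ((z i - z a) / (z i - z j)) = 0 := by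
    refine Finset.sum_eq_zero fun i hi => Finset.sum_eq_zero fun j _ => ?_
    rw [(hA i).1 hi, sub_self, zero_div, mul_zero]
  rw [h1, add_zero] at h0
  have h4 : 1 / 2 * ∑ i ∈ A, ∑ j ∈ A, s.1 i.castSucc j.castSucc = 0 :=
    Complex.ofReal_injective (by push_cast; exact h0)
  rw [mandelstam_map_castSucc]
  linear_combination 2 * h4

/-- Away from the factorization hyperplanes the projection from the space of solutions to the
kinematic space is proper: solutions cannot escape to the boundary of the moduli space. -/
theorem exists_tendsto_solution {m : ℕ} (F : Ultrafilter (Corr m)) {s : Kin (m + 3)}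
    (hU : ∀ A : Finset (Fin (m + 3)), 2 ≤ A.card → A.card ≤ m + 1 → mandelstam s A ≠ 0)
    (hs : Tendsto Prod.fst (F : Filter (Corr m)) (𝓝 s))
    (hF : ∀ᶠ y in (F : Filter (Corr m)), y.2 ∈ solutions y.1) :
    ∃ σ ∈ solutions s, Tendsto Prod.snd (F : Filter (Corr m)) (𝓝 σ) := by
  classical
  have hdich := fun i => tendsto_or_tendsto_cobounded F fun y : Corr m => punctures y.2 i
  have hexcl : ∀ (i : Fin (m + 2)) (w : ℂ),
      Tendsto (fun y : Corr m => punctures y.2 i) F (𝓝 w) →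
      ¬ Tendsto (fun y : Corr m => punctures y.2 i) F (Bornology.cobounded ℂ) := fun i w h h' =>
    h.not_tendsto (Metric.disjoint_nhds_cobounded w) h'
  have h0 : Tendsto (fun y : Corr m => punctures y.2 0) F (𝓝 0) := tendsto_const_nhds
  have h1 : Tendsto (fun y : Corr m => punctures y.2 (Fin.last (m + 1))) F (𝓝 1) := by
    simp only [punctures_last]; exact tendsto_const_nhds
  -- No puncture runs off to infinity.
  have hfin : ∀ i, ∃ w, Tendsto (fun y : Corr m => punctures y.2 i) F (𝓝 w) := by
    by_contra! hcon
    obtain ⟨b, hb⟩ := hcon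
    let A : Finset (Fin (m + 2)) := Finset.univ.filter fun i =>
      Tendsto (fun y : Corr m => punctures y.2 i) F (Bornology.cobounded ℂ)
    have hA : ∀ i, i ∈ A ↔
      Tendsto (fun y : Corr m => punctures y.2 i) F (Bornology.cobounded ℂ) := fun i => by simp [A]
    have hbA : b ∈ A := (hA b).2 ((hdich b).resolve_left fun ⟨w, hw⟩ => hb w hw)
    have h0A : (0 : Fin (m + 2)) ∉ A := fun h => hexcl 0 _ h0 ((hA _).1 h)
    have h1A : Fin.last (m + 1) ∉ A := fun h => hexcl _ _ h1 ((hA _).1 h)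
    choose! z hz using fun i (h : i ∉ A) => (hdich i).resolve_right fun h' => h ((hA i).2 h')
    have hmov : ∀ i ∈ A, ∃ k, i = movable k := fun i hi => by
      rcases eq_zero_or_eq_last_or_eq_movable i with rfl | rfl | h
      exacts [absurd hi h0A, absurd hi h1A, h]
    refine hU _ ?_ ?_ (mandelstam_eq_zero_of_tendsto_cobounded hs hF A
      (fun i hi => (hA i).1 hi) z hz hmov)
    · rw [Finset.card_cons, Finset.card_map]
      have := Finset.card_pos.2 ⟨b, hbA⟩
      omega
    · rw [Finset.card_cons, Finset.card_map]
      have h2 : ({0, Fin.last (m + 1)} : Finset (Fin (m + 2))).card = 2 :=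
        Finset.card_pair (by simp [Fin.ext_iff])
      have h3 : A ⊆ ({0, Fin.last (m + 1)} : Finset (Fin (m + 2)))ᶜ := fun i hi => by
        simp only [Finset.mem_compl, Finset.mem_insert, Finset.mem_singleton, not_or]
        exact ⟨fun h => h0A (h ▸ hi), fun h => h1A (h ▸ hi)⟩
      have h4 := Finset.card_le_card h3
      rw [Finset.card_compl, h2, Fintype.card_fin] at h4
      omega
  choose z hz using hfin
  have hz0 : z 0 = 0 := tendsto_nhds_unique (hz 0) h0
  have hz1 : z (Fin.last (m + 1)) = 1 := tendsto_nhds_unique (hz _) h1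
  -- No two punctures collide.
  have hinj : Function.Injective z := by
    by_contra hcon
    simp only [Function.Injective, not_forall] at hcon
    obtain ⟨b, c, hbc, hne⟩ := hcon
    let A : Finset (Fin (m + 2)) := Finset.univ.filter fun i => z i = z b
    have hA : ∀ i, i ∈ A ↔ z i = z b := fun i => by simp [A]
    obtain ⟨a, haA, ha⟩ : ∃ a ∈ A, ∀ i ∈ A, (∃ k, i = movable k) ∨ i = a := by
      by_cases hA0 : (0 : Fin (m + 2)) ∈ A
      · refine ⟨0, hA0, fun i hi => ?_⟩
        rcases eq_zero_or_eq_last_or_eq_movable i with rfl | rfl | h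
        · exact Or.inr rfl
        · rw [hA, hz1] at hi
          rw [hA, hz0] at hA0
          exact absurd (hA0.trans hi.symm) zero_ne_one
        · exact Or.inl h
      by_cases hA1 : Fin.last (m + 1) ∈ A
      · refine ⟨_, hA1, fun i hi => ?_⟩
        rcases eq_zero_or_eq_last_or_eq_movable i with rfl | rfl | h
        exacts [absurd hi hA0, Or.inr rfl, Or.inl h]
      · refine ⟨b, (hA b).2 rfl, fun i hi => ?_⟩
        rcases eq_zero_or_eq_last_or_eq_movable i with rfl | rfl | h
        exacts [absurd hi hA0, absurd hi hA1, Or.inl h]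
    refine hU _ ?_ ?_ (mandelstam_eq_zero_of_tendsto hs hF z hz A a
      (fun i => by rw [hA, (hA a).1 haA]) ha)
    · rw [Finset.card_map]
      exact Finset.one_lt_card.2 ⟨b, (hA b).2 rfl, c, (hA c).2 hbc.symm, hne⟩
    · rw [Finset.card_map]
      have : A ≠ Finset.univ := fun h => by
        have h2 := (hA 0).1 (h ▸ Finset.mem_univ _)
        have h3 := (hA (Fin.last (m + 1))).1 (h ▸ Finset.mem_univ _)
        rw [hz0] at h2
        rw [hz1] at h3
        exact zero_ne_one (h2.trans h3.symm)
      have h2 := Finset.card_lt_card (Finset.ssubset_univ_iff.2 this)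
      rw [Finset.card_univ, Fintype.card_fin] at h2
      omega
  let σ : Fin m → ℂ := fun k => z (movable k)
  have hsnd : Tendsto Prod.snd (F : Filter (Corr m)) (𝓝 σ) := by
    refine tendsto_pi_nhds.2 fun k => (hz (movable k)).congr fun y => ?_
    rw [punctures_movable]
  have hp : punctures σ = z := by
    funext i
    rcases eq_zero_or_eq_last_or_eq_movable i with rfl | rfl | ⟨k, rfl⟩
    · rw [hz0, punctures_zero]
    · rw [hz1, punctures_last]
    · rw [punctures_movable]
  have hσ : σ ∈ moduli m := by
    change Function.Injective (punctures σ)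
    rwa [hp]
  refine ⟨σ, ⟨hσ, ?_⟩, hsnd⟩
  have hlim := (contDiffAt_scatteringMap (s := s) hσ).continuousAt.tendsto.comp
    (tendsto_id'.2 (show (F : Filter (Corr m)) ≤ 𝓝 (s, σ) from
      tendsto_id'.1 (hs.prodMk_nhds hsnd)))
  refine tendsto_nhds_unique hlim (tendsto_const_nhds.congr' ?_)
  filter_upwards [hF] with y hy
  exact hy.2.symm


/-! ### Solutions of the scattering equations near a generic kinematic point -/

/-- Properness in terms of neighbourhoods: what holds near all solutions over `s` holds at all
solutions over nearby points. -/
theorem eventually_forall_solutions {m : ℕ} {s : Kin (m + 3)}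
    (hU : ∀ A : Finset (Fin (m + 3)), 2 ≤ A.card → A.card ≤ m + 1 → mandelstam s A ≠ 0)
    {P : Corr m → Prop}
    (hP : ∀ σ ∈ solutions s, ∀ᶠ y in 𝓝 (s, σ), y.2 ∈ solutions y.1 → P y) :
    ∀ᶠ s' in 𝓝 s, ∀ σ ∈ solutions s', P (s', σ) := by
  by_contra hcon
  have hne : (comap Prod.fst (𝓝 s) ⊓ 𝓟 {y : Corr m | y.2 ∈ solutions y.1 ∧ ¬ P y}).NeBot := by
    rw [inf_principal_neBot_iff]
    intro V hV
    obtain ⟨W, hW, hWV⟩ := hV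
    by_contra hemp
    refine hcon (mem_of_superset hW fun s' hs' σ hσ => ?_)
    by_contra hPn
    exact hemp ⟨(s', σ), hWV hs', hσ, hPn⟩
  let F := Ultrafilter.of (comap Prod.fst (𝓝 s) ⊓ 𝓟 {y : Corr m | y.2 ∈ solutions y.1 ∧ ¬ P y})
  have hF := Ultrafilter.of_le
    (comap Prod.fst (𝓝 s) ⊓ 𝓟 {y : Corr m | y.2 ∈ solutions y.1 ∧ ¬ P y})
  have h1 : Tendsto Prod.fst (F : Filter (Corr m)) (𝓝 s) :=
    tendsto_iff_comap.2 (hF.trans inf_le_left)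
  have h2 : ∀ᶠ y in (F : Filter (Corr m)), y.2 ∈ solutions y.1 ∧ ¬ P y :=
    le_principal_iff.1 (hF.trans inf_le_right)
  obtain ⟨σ, hσ, h3⟩ := exists_tendsto_solution F hU h1 (h2.mono fun _ h => h.1)
  obtain ⟨y, hy⟩ := (h2.and ((h1.prodMk_nhds h3).eventually (hP σ hσ))).exists
  exact hy.1.2 (hy.2 hy.1.1)

theorem isOpen_genericLocus (m : ℕ) : IsOpen (genericLocus m) := by
  refine isOpen_iff_mem_nhds.2 fun s hs => ?_
  have h1 : ∀ᶠ s' in 𝓝 s, ∀ A : Finset (Fin (m + 3)), 2 ≤ A.card → A.card ≤ m + 1 →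
      mandelstam s' A ≠ 0 := by
    refine eventually_all.2 fun A => ?_
    by_cases h2 : 2 ≤ A.card ∧ A.card ≤ m + 1
    · filter_upwards [(continuous_mandelstam A).continuousAt.eventually_ne (hs.1 A h2.1 h2.2)]
        with s' hs' _ _ using hs'
    · exact Eventually.of_forall fun s' h3 h4 => absurd ⟨h3, h4⟩ h2
  have h2 := eventually_forall_solutions hs.1 (P := fun y => realJacobian y.1 y.2 ≠ 0)
    fun σ hσ => ((contDiffAt_realJacobian hσ.1).continuousAt.eventually_ne
      ((realJacobian_ne_zero_iff s hσ.1).2 (hs.2 σ hσ))).mono fun _ h _ => h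
  filter_upwards [h1, h2] with s' h3 h4
  exact ⟨h3, fun σ hσ => (realJacobian_ne_zero_iff s' hσ.1).1 (h4 σ hσ)⟩

/-- A nondegenerate solution of the scattering equations extends uniquely to a smooth family of
solutions over nearby kinematic points. -/
theorem exists_solution_branch {m : ℕ} {s : Kin (m + 3)} {σ : Fin m → ℂ} (hσ : σ ∈ solutions s)
    (hJ : realJacobian s σ ≠ 0) :
    ∃ g : Kin (m + 3) → Fin m → ℂ, ContDiffAt ℝ ∞ g s ∧ g s = σ ∧
      ∀ᶠ y : Corr m in 𝓝 (s, σ), y.2 ∈ solutions y.1 ↔ y.2 = g y.1 := by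
  have hc := contDiffAt_scatteringMap (s := s) hσ.1
  have hinv : (fderiv ℝ (fun y : Corr m => scatteringMap y.1 y.2) (s, σ) ∘L
      ContinuousLinearMap.inr ℝ (Kin (m + 3)) (Fin m → ℂ)).IsInvertible := by
    rw [← fderiv_scatteringMap_eq s hσ.1]
    exact ⟨ContinuousLinearMap.toContinuousLinearEquivOfDetNeZero _ hJ,
      ContinuousLinearMap.coe_toContinuousLinearEquivOfDetNeZero _ hJ⟩
  refine ⟨hc.implicitFunction (by simp) hinv, hc.contDiffAt_implicitFunction (by simp) hinv,
    hc.implicitFunction_apply_self (by simp) hinv, ?_⟩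
  have hm : ∀ᶠ y : Corr m in 𝓝 (s, σ), y.2 ∈ moduli m :=
    continuousAt_snd ((isOpen_moduli m).mem_nhds hσ.1)
  filter_upwards [hm, hc.eventually_apply_eq_iff_implicitFunction (by simp) hinv] with y hy h
  rw [hσ.2] at h
  exact ⟨fun h' => (h.1 h'.2).symm, fun h' => ⟨hy, h.2 h'.symm⟩⟩

theorem realJacobian_ne_zero {m : ℕ} {s : Kin (m + 3)} (hs : s ∈ genericLocus m) {σ : Fin m → ℂ}
    (hσ : σ ∈ solutions s) : realJacobian s σ ≠ 0 :=
  (realJacobian_ne_zero_iff s hσ.1).2 (hs.2 σ hσ)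

theorem isCompact_solutions {m : ℕ} {s : Kin (m + 3)} (hs : s ∈ genericLocus m) :
    IsCompact (solutions s) := by
  rw [isCompact_iff_ultrafilter_le_nhds]
  intro G hG
  have hG' : ∀ᶠ σ in (G : Filter (Fin m → ℂ)), σ ∈ solutions s := le_principal_iff.1 hG
  obtain ⟨σ, hσ, h⟩ := exists_tendsto_solution (G.map fun σ => ((s, σ) : Corr m)) hs.1
    (by rw [Ultrafilter.coe_map, tendsto_map'_iff]; exact tendsto_const_nhds)
    (by rw [Ultrafilter.coe_map, eventually_map]; exact hG')
  rw [Ultrafilter.coe_map, tendsto_map'_iff] at h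
  exact ⟨σ, hσ, tendsto_id'.1 h⟩

theorem finite_solutions {m : ℕ} {s : Kin (m + 3)} (hs : s ∈ genericLocus m) :
    (solutions s).Finite := by
  by_contra hinf
  obtain ⟨σ, hσ, hne⟩ := exists_nhds_ne_inf_principal_neBot (isCompact_solutions hs) hinf
  obtain ⟨g, -, hg, hev⟩ := exists_solution_branch hσ (realJacobian_ne_zero hs hσ)
  have h1 : ∀ᶠ τ in 𝓝 σ, τ ∈ solutions s ↔ τ = g s :=
    ((Continuous.prodMk_right s).tendsto σ).eventually hev
  rw [hg] at h1
  have h2 : ∀ᶠ τ in 𝓝[≠] σ ⊓ 𝓟 (solutions s), False := by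
    have h3 : ∀ᶠ τ in 𝓝[≠] σ ⊓ 𝓟 (solutions s), τ ≠ σ :=
      Eventually.filter_mono inf_le_left self_mem_nhdsWithin
    have h4 : ∀ᶠ τ in 𝓝[≠] σ ⊓ 𝓟 (solutions s), τ ∈ solutions s :=
      Eventually.filter_mono inf_le_right (mem_principal_self _)
    filter_upwards [h3, h4, h1.filter_mono (inf_le_left.trans nhdsWithin_le_nhds)] with τ a b c
    exact a (c.1 b)
  exact h2.exists.elim fun _ h => h

/-- A sum over the solutions of the scattering equations of a smooth function on the correspondence
space depends smoothly on the generic kinematic point. -/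
theorem contDiffAt_sum_solutions {m : ℕ} {s : Kin (m + 3)} (hs : s ∈ genericLocus m)
    {H : Corr m → ℂ} (hH : ∀ σ ∈ solutions s, ContDiffAt ℝ ∞ H (s, σ)) :
    ContDiffAt ℝ ∞ (fun s' => ∑ᶠ σ ∈ solutions s', H (s', σ)) s := by
  choose! g hg hgs hgev using fun σ (hσ : σ ∈ solutions s) =>
    exists_solution_branch hσ (realJacobian_ne_zero hs hσ)
  have hfin := finite_solutions hs
  have hpair : ∀ σ ∈ solutions s, Tendsto (fun s' => ((s', g σ s') : Corr m)) (𝓝 s) (𝓝 (s, σ)) :=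
    fun σ hσ => by
      have := (hg σ hσ).continuousAt.tendsto
      rw [hgs σ hσ] at this
      exact tendsto_id.prodMk_nhds this
  have h1 : ∀ᶠ s' in 𝓝 s, ∀ σ ∈ solutions s, g σ s' ∈ solutions s' := by
    refine (eventually_all_finite hfin).2 fun σ hσ => ?_
    filter_upwards [(hpair σ hσ).eventually (hgev σ hσ)] with s' h
    exact h.2 rfl
  have h2 : ∀ᶠ s' in 𝓝 s, ∀ σ ∈ solutions s, ∀ τ ∈ solutions s, σ ≠ τ → g σ s' ≠ g τ s' := by
    refine (eventually_all_finite hfin).2 fun σ hσ => (eventually_all_finite hfin).2 fun τ hτ => ?_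
    refine eventually_imp_distrib_left.2 fun hne => ?_
    refine ((hg σ hσ).continuousAt.ne_iff_eventually_ne (hg τ hτ).continuousAt).1 ?_
    rwa [hgs σ hσ, hgs τ hτ]
  have h3 : ∀ᶠ s' in 𝓝 s, ∀ τ ∈ solutions s', ∃ σ ∈ solutions s, τ = g σ s' := by
    refine eventually_forall_solutions hs.1
      (P := fun y => ∃ σ ∈ solutions s, y.2 = g σ y.1) fun σ hσ => ?_
    exact (hgev σ hσ).mono fun y h hy => ⟨σ, hσ, h.1 hy⟩
  have hsum : (fun s' => ∑ᶠ σ ∈ solutions s', H (s', σ)) =ᶠ[𝓝 s]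
      fun s' => ∑ σ ∈ hfin.toFinset, H (s', g σ s') := by
    filter_upwards [h1, h2, h3] with s' a b c
    have himg : solutions s' = (fun σ => g σ s') '' solutions s := by
      ext τ
      constructor
      · intro h
        obtain ⟨σ, hσ, rfl⟩ := c τ h
        exact ⟨σ, hσ, rfl⟩
      · rintro ⟨σ, hσ, rfl⟩
        exact a σ hσ
    rw [himg, finsum_mem_image fun σ hσ τ hτ h => by_contra fun hne => b σ hσ τ hτ hne h,
      finsum_mem_eq_finite_toFinset_sum _ hfin]
  refine ContDiffAt.congr_of_eventuallyEq (ContDiffAt.sum fun σ hσ => ?_) hsum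
  rw [Set.Finite.mem_toFinset] at hσ
  refine ContDiffAt.comp s (g := H) (f := fun s' => ((s', g σ s') : Corr m)) ?_
    (contDiffAt_id.prodMk (hg σ hσ))
  rw [hgs σ hσ]
  exact hH σ hσ

/-! ### Existence of mollifiers and cutoffs -/

theorem exists_isMollifier : ∃ ρ : ℂ → ℝ, IsMollifier ρ := by
  let f : ContDiffBump (0 : ℂ) := ⟨1, 2, one_pos, one_lt_two⟩
  exact ⟨f.normed volume, f.contDiff_normed, f.hasCompactSupport_normed, f.integral_normed⟩

theorem exists_isCutoff {m : ℕ} {s : Kin (m + 3)} (hs : s ∈ genericLocus m) :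
    ∃ χ : (Fin m → ℂ) → ℝ, IsCutoff s χ := by
  obtain ⟨K, hK, h1, h2⟩ := exists_compact_between (isCompact_solutions hs) (isOpen_moduli m)
    fun σ hσ => hσ.1
  obtain ⟨f, hf1, hf0, -⟩ := exists_contMDiffMap_one_nhds_of_subset_interior (n := ⊤)
    (modelWithCornersSelf ℝ (Fin m → ℂ)) (isCompact_solutions hs).isClosed h1
  have hsupp : tsupport f ⊆ K :=
    closure_minimal (fun σ hσ => by_contra fun h => hσ (hf0 σ h)) hK.isClosed
  exact ⟨f, f.contMDiff.contDiff, hK.of_isClosed_subset (isClosed_tsupport _) hsupp,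
    hsupp.trans h2, fun σ hσ => hf1.filter_mono (nhds_le_nhdsSet hσ)⟩


/-! ### Concentration of approximate delta functions -/

section Delta

variable {V : Type*} [NormedAddCommGroup V] [NormedSpace ℝ V] [FiniteDimensional ℝ V]
  [MeasurableSpace V] [BorelSpace V] (μ : Measure V) [μ.IsAddHaarMeasure]

/-- The rescalings `ε^{-d} φ(x / ε)` converge to `∫ φ` times the delta function at the origin. The
function `φ` may change sign. -/
theorem tendsto_setIntegral_ball_rescale {φ : V → ℝ} (hφ : Continuous φ)
    (hφ' : HasCompactSupport φ) {r : ℝ} (hr : 0 < r) {k : V → ℂ}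
    (hk : ContinuousOn k (Metric.closedBall 0 r)) :
    Tendsto (fun ε : ℝ => ∫ x in Metric.ball 0 r,
      (ε⁻¹ ^ Module.finrank ℝ V * φ (ε⁻¹ • x)) • k x ∂μ) (𝓝[>] 0) (𝓝 ((∫ x, φ x ∂μ) • k 0)) := by
  classical
  let K : V → ℂ := (Metric.ball (0 : V) r).piecewise k fun _ => 0
  have hKm : Measurable K :=
    (hk.mono Metric.ball_subset_closedBall).measurable_piecewise continuousOn_const
      measurableSet_ball
  obtain ⟨C, hC⟩ := (isCompact_closedBall (0 : V) r).exists_bound_of_continuousOn hk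
  have hC0 : 0 ≤ C := (norm_nonneg _).trans (hC 0 (Metric.mem_closedBall_self hr.le))
  have hKC : ∀ x, ‖K x‖ ≤ C := fun x => by
    by_cases hx : x ∈ Metric.ball (0 : V) r
    · simpa [K, Set.piecewise_eq_of_mem _ _ _ hx] using hC x (Metric.ball_subset_closedBall hx)
    · simpa [K, Set.piecewise_eq_of_notMem _ _ _ hx] using hC0
  have hKk : K =ᶠ[𝓝 0] k := by
    filter_upwards [Metric.ball_mem_nhds (0 : V) hr] with x hx
    exact Set.piecewise_eq_of_mem _ _ _ hx
  have hKcont : ContinuousAt K 0 :=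
    (hk.continuousAt (Metric.closedBall_mem_nhds _ hr)).congr hKk.symm
  have hlim : Tendsto (fun ε : ℝ => ∫ x, φ x • K (ε • x) ∂μ) (𝓝[>] 0)
      (𝓝 (∫ x, φ x • K 0 ∂μ)) := by
    refine tendsto_integral_filter_of_dominated_convergence (fun x => ‖φ x‖ * C) ?_ ?_ ?_ ?_
    · refine Eventually.of_forall fun ε => ?_
      exact hφ.aestronglyMeasurable.smul
        (hKm.comp (measurable_const_smul ε)).aestronglyMeasurable
    · refine Eventually.of_forall fun ε => Eventually.of_forall fun x => ?_
      rw [norm_smul]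
      exact mul_le_mul_of_nonneg_left (hKC _) (norm_nonneg _)
    · exact ((hφ.integrable_of_hasCompactSupport hφ').norm).mul_const C
    · refine Eventually.of_forall fun x => Tendsto.const_smul ?_ _
      refine hKcont.tendsto.comp ?_
      have : Tendsto (fun ε : ℝ => ε • x) (𝓝 0) (𝓝 ((0 : ℝ) • x)) :=
        tendsto_id.smul_const x
      rw [zero_smul] at this
      exact this.mono_left nhdsWithin_le_nhds
  rw [integral_smul_const, hKk.self_of_nhds] at hlim
  refine hlim.congr' ?_
  filter_upwards [self_mem_nhdsWithin] with ε hε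
  have hε : 0 < ε := hε
  have h1 : ∀ x, φ (ε⁻¹ • x) • K x = (fun u => φ u • K (ε • u)) (ε⁻¹ • x) := fun x => by
    simp only [smul_inv_smul₀ hε.ne']
  have h2 : ∫ x in Metric.ball 0 r, (ε⁻¹ ^ Module.finrank ℝ V * φ (ε⁻¹ • x)) • k x ∂μ =
      ∫ x, (ε⁻¹ ^ Module.finrank ℝ V * φ (ε⁻¹ • x)) • K x ∂μ := by
    rw [← integral_indicator measurableSet_ball]
    refine integral_congr_ae (Eventually.of_forall fun x => ?_)
    by_cases hx : x ∈ Metric.ball (0 : V) r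
    · simp [K, Set.piecewise_eq_of_mem _ _ _ hx, Set.indicator_of_mem hx]
    · simp [K, Set.piecewise_eq_of_notMem _ _ _ hx, Set.indicator_of_notMem hx]
  rw [h2]
  simp only [mul_smul, integral_smul, h1]
  rw [Measure.integral_comp_inv_smul_of_nonneg μ (fun u => φ u • K (ε • u)) hε.le, smul_smul,
    ← mul_pow, inv_mul_cancel₀ hε.ne', one_pow, one_smul]

/-- Near a nondegenerate zero `a` of `E`, the functions `ε^{-d} φ(E / ε)` converge to
`∫ φ / |det E'(a)|` times the delta function at `a`, by the change of variables `τ = E x`. -/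
theorem exists_tendsto_setIntegral_rescale_comp {E : V → V} {O : Set V} (hO : IsOpen O)
    (hE : ContDiffOn ℝ 1 E O) {a : V} (ha : a ∈ O) (hEa : E a = 0)
    (hdet : (fderiv ℝ E a).det ≠ 0) {H : V → ℂ} (hH : Continuous H) {φ : V → ℝ}
    (hφ : Continuous φ) (hφ' : HasCompactSupport φ) {N : Set V} (hN : N ∈ 𝓝 a) :
    ∃ W ⊆ N, IsOpen W ∧ a ∈ W ∧
      Tendsto (fun ε : ℝ => ∫ x in W, (ε⁻¹ ^ Module.finrank ℝ V * φ (ε⁻¹ • E x)) • H x ∂μ)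
        (𝓝[>] 0) (𝓝 ((∫ x, φ x ∂μ) • |(fderiv ℝ E a).det|⁻¹ • H a)) := by
  have hEat : ∀ x ∈ O, ContDiffAt ℝ 1 E x := fun x hx => hE.contDiffAt (hO.mem_nhds hx)
  have hcd : ContinuousOn (fun x => (fderiv ℝ E x).det) O :=
    ContinuousLinearMap.continuous_det.comp_continuousOn
      (hE.continuousOn_fderiv_of_isOpen hO le_rfl)
  let e' := (fderiv ℝ E a).toContinuousLinearEquivOfDetNeZero hdet
  have he' : HasFDerivAt E (e' : V →L[ℝ] V) a := by
    rw [ContinuousLinearMap.coe_toContinuousLinearEquivOfDetNeZero]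
    exact ((hEat a ha).differentiableAt one_ne_zero).hasFDerivAt
  let e := (hEat a ha).toOpenPartialHomeomorph E he' one_ne_zero
  have hecoe : (e : V → V) = E := (hEat a ha).toOpenPartialHomeomorph_coe he' one_ne_zero
  have hasrc : a ∈ e.source := (hEat a ha).mem_toOpenPartialHomeomorph_source he' one_ne_zero
  have hatgt : (0 : V) ∈ e.target := by
    have := e.map_source hasrc
    rwa [hecoe, hEa] at this
  have hsymm : e.symm 0 = a := by
    have := e.left_inv hasrc
    rwa [hecoe, hEa] at this
  have hN' : N ∩ O ∩ {x | (fderiv ℝ E x).det ≠ 0} ∈ 𝓝 a :=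
    inter_mem (inter_mem hN (hO.mem_nhds ha))
      ((hcd.continuousAt (hO.mem_nhds ha)).eventually_ne hdet)
  have hpre : e.target ∩ e.symm ⁻¹' (N ∩ O ∩ {x | (fderiv ℝ E x).det ≠ 0}) ∈ 𝓝 (0 : V) := by
    refine inter_mem (e.open_target.mem_nhds hatgt) ?_
    refine (e.continuousAt_symm hatgt).preimage_mem_nhds ?_
    rwa [hsymm]
  obtain ⟨r, hr, hball⟩ := Metric.nhds_basis_closedBall.mem_iff.1 hpre
  -- With this choice `E` maps `W` bijectively onto a ball.
  let W := e.symm '' Metric.ball 0 r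
  have hbt : Metric.ball 0 r ⊆ e.target := fun x hx =>
    (hball (Metric.ball_subset_closedBall hx)).1
  have hWN : ∀ x ∈ W, x ∈ N ∩ O ∩ {x | (fderiv ℝ E x).det ≠ 0} := by
    rintro _ ⟨τ, hτ, rfl⟩
    exact (hball (Metric.ball_subset_closedBall hτ)).2
  have hWopen : IsOpen W := e.isOpen_image_symm_of_subset_target Metric.isOpen_ball hbt
  have himg : E '' W = Metric.ball 0 r := by
    rw [← hecoe, Set.image_image]
    exact (Set.image_congr fun τ hτ => e.right_inv (hbt hτ)).trans (Set.image_id' _)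
  have hinj : Set.InjOn E W := by
    rintro _ ⟨τ, hτ, rfl⟩ _ ⟨τ', hτ', rfl⟩ h
    rw [← hecoe, e.right_inv (hbt hτ), e.right_inv (hbt hτ')] at h
    rw [h]
  refine ⟨W, fun x hx => (hWN x hx).1.1, hWopen,
    ⟨0, Metric.mem_ball_self hr, hsymm⟩, ?_⟩
  let k : V → ℂ := fun τ => |(fderiv ℝ E (e.symm τ)).det|⁻¹ • H (e.symm τ)
  have hk : ContinuousOn k (Metric.closedBall 0 r) := by
    have h1 : ContinuousOn e.symm (Metric.closedBall 0 r) :=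
      e.continuousOn_symm.mono fun x hx => (hball hx).1
    have h2 : ContinuousOn (fun τ => |(fderiv ℝ E (e.symm τ)).det|) (Metric.closedBall 0 r) :=
      (hcd.comp h1 fun x hx => (hball hx).2.1.2).abs
    exact (h2.inv₀ fun x hx => abs_ne_zero.2 (hball hx).2.2).smul (hH.comp_continuousOn h1)
  have hlim := tendsto_setIntegral_ball_rescale μ hφ hφ' hr hk
  simp only [k, hsymm] at hlim
  refine hlim.congr fun ε => ?_
  -- The weight `1 / |det E'|` in `k` compensates the Jacobian of the substitution.
  rw [← himg, integral_image_eq_integral_abs_det_fderiv_smul μ hWopen.measurableSet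
    (fun x hx =>
      ((hEat x (hWN x hx).1.2).differentiableAt one_ne_zero).hasFDerivAt.hasFDerivWithinAt)
    hinj]
  refine setIntegral_congr_fun hWopen.measurableSet fun x hx => ?_
  obtain ⟨τ, hτ, rfl⟩ := hx
  have hne : |(fderiv ℝ E (e.symm τ)).det| ≠ 0 := abs_ne_zero.2 (hWN _ ⟨τ, hτ, rfl⟩).2
  have hEe : E (e.symm τ) = τ := by rw [← hecoe]; exact e.right_inv (hbt hτ)
  simp only [hEe]
  rw [smul_comm, smul_smul _ _ (H _), mul_inv_cancel₀ hne, one_smul]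

/-- If `E` has finitely many zeros, all of them nondegenerate, then `ε^{-d} φ(E / ε)` converges to
`∫ φ` times the sum of the delta functions at the zeros with weights `1 / |det E'|`. -/
theorem tendsto_integral_rescale_comp {E : V → V} {O : Set V} (hO : IsOpen O)
    (hE : ContDiffOn ℝ 1 E O) {S : Set V} (hS : S.Finite) (hSE : ∀ x, x ∈ S ↔ x ∈ O ∧ E x = 0)
    (hdet : ∀ x ∈ S, (fderiv ℝ E x).det ≠ 0) {H : V → ℂ} (hH : Continuous H)
    (hHc : HasCompactSupport H) (hHO : tsupport H ⊆ O) {φ : V → ℝ} (hφ : Continuous φ)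
    (hφ' : HasCompactSupport φ) :
    Tendsto (fun ε : ℝ => ∫ x, (ε⁻¹ ^ Module.finrank ℝ V * φ (ε⁻¹ • E x)) • H x ∂μ)
      (𝓝[>] 0) (𝓝 (∑ᶠ a ∈ S, (∫ x, φ x ∂μ) • |(fderiv ℝ E a).det|⁻¹ • H a)) := by
  obtain ⟨N, hN, hNd⟩ := hS.t2_separation
  choose! W hWN hWo haW hWlim using fun a (ha : a ∈ S) =>
    exists_tendsto_setIntegral_rescale_comp μ hO hE ((hSE a).1 ha).1 ((hSE a).1 ha).2 (hdet a ha)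
      hH hφ hφ' ((hN a).2.mem_nhds (hN a).1)
  have hWd : S.PairwiseDisjoint W := fun a ha b hb hab =>
    (hNd ha hb hab).mono (hWN a ha) (hWN b hb)
  have hUo : IsOpen (⋃ a ∈ S, W a) := isOpen_biUnion hWo
  have hKc : IsCompact (tsupport H \ ⋃ a ∈ S, W a) := hHc.isCompact.diff hUo
  obtain ⟨δ, hδ, hδE⟩ : ∃ δ > 0, ∀ x ∈ tsupport H \ ⋃ a ∈ S, W a, δ < ‖E x‖ := by
    have h1 : IsClosed (E '' (tsupport H \ ⋃ a ∈ S, W a)) :=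
      (hKc.image_of_continuousOn (hE.continuousOn.mono fun x hx => hHO hx.1)).isClosed
    have h2 : (0 : V) ∉ E '' (tsupport H \ ⋃ a ∈ S, W a) := by
      rintro ⟨x, hx, h0⟩
      have hxS := (hSE x).2 ⟨hHO hx.1, h0⟩
      exact hx.2 (Set.mem_biUnion hxS (haW x hxS))
    obtain ⟨δ, hδ, h3⟩ := Metric.nhds_basis_closedBall.mem_iff.1 (h1.isOpen_compl.mem_nhds h2)
    refine ⟨δ, hδ, fun x hx => ?_⟩
    by_contra hle
    exact h3 (mem_closedBall_zero_iff.2 (not_lt.1 hle)) ⟨x, hx, rfl⟩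
  obtain ⟨R, hR, hφR⟩ : ∃ R > 0, ∀ x, φ x ≠ 0 → ‖x‖ ≤ R := by
    obtain ⟨R, hR, h⟩ := hφ'.isCompact.isBounded.subset_closedBall_lt 0 0
    exact ⟨R, hR, fun x hx => mem_closedBall_zero_iff.1 (h (subset_tsupport _ hx))⟩
  rw [finsum_mem_eq_finite_toFinset_sum _ hS]
  have hlim := tendsto_finsetSum hS.toFinset fun a ha => hWlim a (hS.mem_toFinset.1 ha)
  refine hlim.congr' ?_
  filter_upwards [self_mem_nhdsWithin, mem_nhdsWithin_of_mem_nhds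
    (Iio_mem_nhds (div_pos hδ hR))] with ε hε hε'
  have hε : 0 < ε := hε
  have hεR : ε * R < δ := (lt_div_iff₀ hR).1 hε'
  have hcont : Continuous fun x => (ε⁻¹ ^ Module.finrank ℝ V * φ (ε⁻¹ • E x)) • H x := by
    refine continuous_of_tsupport fun x hx => ?_
    have hx' : x ∈ O := hHO (tsupport_smul_subset_right _ _ hx)
    have hEx : ContinuousAt E x := hE.continuousOn.continuousAt (hO.mem_nhds hx')
    exact (continuousAt_const.mul (hφ.continuousAt.comp (hEx.const_smul _))).smul hH.continuousAt
  have hint : Integrable (fun x => (ε⁻¹ ^ Module.finrank ℝ V * φ (ε⁻¹ • E x)) • H x) μ :=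
    hcont.integrable_of_hasCompactSupport <|
      hHc.mono fun x hx h0 => hx (by simp only [h0, smul_zero])
  have hzero : ∀ x, x ∉ ⋃ a ∈ hS.toFinset, W a →
      (ε⁻¹ ^ Module.finrank ℝ V * φ (ε⁻¹ • E x)) • H x = 0 := fun x hx => by
    by_contra hne
    have hHx : H x ≠ 0 := right_ne_zero_of_smul hne
    have hφx : φ (ε⁻¹ • E x) ≠ 0 := right_ne_zero_of_mul (left_ne_zero_of_smul hne)
    have h1 := hφR _ hφx
    rw [norm_smul, norm_inv, Real.norm_of_nonneg hε.le, inv_mul_le_iff₀ hε] at h1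
    have h2 := hδE x ⟨subset_tsupport _ hHx, by simpa using hx⟩
    linarith
  rw [← setIntegral_eq_integral_of_forall_compl_eq_zero hzero,
    integral_biUnion_finset _ (fun a ha => (hWo a (hS.mem_toFinset.1 ha)).measurableSet)
      (by rwa [hS.coe_toFinset]) fun a _ => hint.integrableOn]

end Delta


/-! ### Forms on twistor space and on the correspondence space -/

section Wedge

variable {V W : Type*} [AddCommGroup V] [Module ℝ V] [AddCommGroup W] [Module ℝ W] {k l : ℕ}

theorem alternatingMap_sum_apply {ι κ : Type*} (s : Finset κ) (F : κ → V [⋀^ι]→ₗ[ℝ] ℂ)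
    (v : ι → V) : (∑ i ∈ s, F i) v = ∑ i ∈ s, F i v := by
  classical
  induction s using Finset.induction_on with
  | empty => simp
  | insert a s ha ih =>
    rw [Finset.sum_insert ha, Finset.sum_insert ha, AlternatingMap.add_apply, ih]

theorem wedge_smul_left (c : ℝ) (a : V [⋀^Fin k]→ₗ[ℝ] ℂ) (b : V [⋀^Fin l]→ₗ[ℝ] ℂ) :
    wedge (c • a) b = c • wedge a b := by
  have h : (c • a).domCoprod b = c • a.domCoprod b := by
    simp only [← AlternatingMap.domCoprod'_apply, ← TensorProduct.smul_tmul', map_smul]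
  ext v
  simp [wedge, h]

theorem wedge_smul_right (c : ℝ) (a : V [⋀^Fin k]→ₗ[ℝ] ℂ) (b : V [⋀^Fin l]→ₗ[ℝ] ℂ) :
    wedge a (c • b) = c • wedge a b := by
  have h : a.domCoprod (c • b) = c • a.domCoprod b := by
    simp only [← AlternatingMap.domCoprod'_apply, TensorProduct.tmul_smul, map_smul]
  ext v
  simp [wedge, h]

theorem wedge_compLinearMap (a : V [⋀^Fin k]→ₗ[ℝ] ℂ) (b : V [⋀^Fin l]→ₗ[ℝ] ℂ) (f : W →ₗ[ℝ] V) :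
    wedge (a.compLinearMap f) (b.compLinearMap f) = (wedge a b).compLinearMap f := by
  have h : (a.compLinearMap f).domCoprod (b.compLinearMap f) =
      (a.domCoprod b).compLinearMap f := by
    ext v
    simp only [AlternatingMap.domCoprod_apply, AlternatingMap.compLinearMap_apply, _root_.sum_apply]
    refine Finset.sum_congr rfl fun π _ => ?_
    induction π using Quotient.inductionOn'
    simp [AlternatingMap.domCoprod.summand_mk'']
  ext v
  simp [wedge, h]
  rfl

theorem wedgeOneForms_smul : ∀ (k : ℕ) (r : Fin k → ℝ) (θ : Fin k → V →ₗ[ℝ] ℂ),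
    wedgeOneForms k (fun i => r i • θ i) = (∏ i, r i) • wedgeOneForms k θ
  | 0, r, θ => by simp [wedgeOneForms]
  | k + 1, r, θ => by
    have h : oneForm (r (Fin.last k) • θ (Fin.last k)) =
        r (Fin.last k) • oneForm (θ (Fin.last k)) := by
      ext v; simp [oneForm]
    simp only [wedgeOneForms]
    rw [wedgeOneForms_smul k (fun i => r i.castSucc) fun i => θ i.castSucc, h, wedge_smul_left,
      wedge_smul_right, smul_smul, Fin.prod_univ_castSucc]

theorem wedgeOneForms_compLinearMap (f : W →ₗ[ℝ] V) : ∀ (k : ℕ) (θ : Fin k → V →ₗ[ℝ] ℂ),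
    (wedgeOneForms k θ).compLinearMap f = wedgeOneForms k fun i => θ i ∘ₗ f
  | 0, θ => by ext; simp [wedgeOneForms]
  | k + 1, θ => by
    simp only [wedgeOneForms]
    rw [← wedge_compLinearMap, wedgeOneForms_compLinearMap f k]
    rfl

theorem wedgePow_smul (c : ℝ) (β : V [⋀^Fin 2]→ₗ[ℝ] ℂ) : ∀ k : ℕ,
    wedgePow (c • β) k = c ^ k • wedgePow β k
  | 0 => by simp [wedgePow]
  | k + 1 => by
    simp only [wedgePow]
    rw [wedgePow_smul c β k]
    erw [wedge_smul_left, wedge_smul_right]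
    rw [smul_smul, pow_succ]

theorem wedgePow_compLinearMap (f : W →ₗ[ℝ] V) (β : V [⋀^Fin 2]→ₗ[ℝ] ℂ) : ∀ k : ℕ,
    (wedgePow β k).compLinearMap f = wedgePow (β.compLinearMap f) k
  | 0 => by ext; simp [wedgePow]
  | k + 1 => by
    simp only [wedgePow]
    rw [← wedgePow_compLinearMap f β k]
    exact (wedge_compLinearMap _ _ _).symm

end Wedge

/-- The constant form on twistor space `⋀ (dτ̄_i / 2i) ∧ ω^{n-3}`, that is, `δ̄^{n-3}(τ) ∧ ω^{n-3}`
without its delta functions. -/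
noncomputable def twistorForm (m : ℕ) : Twistor m [⋀^Fin (m + 2 * m)]→ₗ[ℝ] ℂ :=
  wedge (wedgeOneForms m fun i => (1 / (2 * Complex.I)) • dTauBar i)
    (wedgePow (symplecticForm m) m)

theorem wedge_deltaBarForm_eq {m : ℕ} (ρ : ℂ → ℝ) (ε : ℝ) (x : Twistor m) :
    wedge (deltaBarForm ρ ε x) (wedgePow (symplecticForm m) m) =
      (∏ i, ε⁻¹ ^ 2 * ρ ((ε⁻¹ : ℂ) * x.1 i)) • twistorForm m := by
  rw [twistorForm, ← wedge_smul_left, ← wedgeOneForms_smul]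
  congr 1
  unfold deltaBarForm
  congr 1
  funext i
  refine LinearMap.ext fun v => ?_
  simp only [LinearMap.smul_apply, Complex.real_smul, smul_eq_mul]
  ring

/-- The dilation `(τ, σ) ↦ (c τ, σ)` of the cotangent fibres. -/
noncomputable def dilation (m : ℕ) (c : ℝ) : Twistor m →L[ℝ] Twistor m :=
  (c • ContinuousLinearMap.fst ℝ (Fin m → ℂ) (Fin m → ℂ)).prod
    (ContinuousLinearMap.snd ℝ (Fin m → ℂ) (Fin m → ℂ))

theorem twistorForm_dilation (m : ℕ) (c : ℝ) :
    (twistorForm m).compLinearMap (dilation m c).toLinearMap = c ^ (2 * m) • twistorForm m := by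
  have h1 : ∀ i, ((1 / (2 * Complex.I)) • dTauBar i) ∘ₗ (dilation m c).toLinearMap =
      c • ((1 / (2 * Complex.I)) • dTauBar (m := m) i) := by
    intro i
    ext v <;> simp [dTauBar, dTau, dilation]
    all_goals ring
  have h2 : (symplecticForm m).compLinearMap (dilation m c).toLinearMap =
      c • symplecticForm m := by
    have h3 : ∀ i : Fin m, (oneForm (dTau i)).compLinearMap (dilation m c).toLinearMap =
        c • oneForm (dTau i) := by
      intro i; ext v; simp [oneForm, dTau, dilation]
    have h4 : ∀ i : Fin m, (oneForm (dSigma i)).compLinearMap (dilation m c).toLinearMap =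
        oneForm (dSigma i) := by
      intro i; ext v; simp [oneForm, dSigma, dilation]
    rw [symplecticForm, Finset.smul_sum]
    have h5 : ∀ F : Fin m → Twistor m [⋀^Fin 2]→ₗ[ℝ] ℂ,
        (∑ i, F i).compLinearMap (dilation m c).toLinearMap =
          ∑ i, (F i).compLinearMap (dilation m c).toLinearMap := fun F => by
      ext v
      simp only [AlternatingMap.compLinearMap_apply, alternatingMap_sum_apply]
    refine (h5 _).trans ?_
    refine Finset.sum_congr rfl fun i _ => ?_
    rw [← wedge_compLinearMap, h3, h4, wedge_smul_left]
  rw [twistorForm, ← wedge_compLinearMap, wedgeOneForms_compLinearMap, wedgePow_compLinearMap, h2,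
    wedgePow_smul, wedge_smul_right]
  simp only [h1]
  rw [wedgeOneForms_smul m (fun _ => c), wedge_smul_left, smul_smul]
  simp [two_mul, pow_add]

theorem append_update_left {X Y : Type*} {k l : ℕ} [DecidableEq (Fin k)] (f : X → Y)
    (v : Fin k → X) (j : Fin k) (z : X) (w : Fin l → Y) :
    Fin.append (fun i => f (Function.update v j z i)) w =
      Function.update (Fin.append (fun i => f (v i)) w) (Fin.castAdd l j) (f z) := by
  funext i
  refine Fin.addCases (fun i => ?_) (fun i => ?_) i
  · by_cases h : i = j
    · subst h; simp
    · have h' : Fin.castAdd l i ≠ Fin.castAdd l j := fun e => h (Fin.castAdd_injective _ _ e)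
      simp [h, h']
  · have h' : Fin.natAdd k i ≠ Fin.castAdd l j := fun e => by
      have := congrArg Fin.val e
      simp at this
      omega
    simp [h']

/-- `fibreCoefficient` as an alternating form in the tangent vectors of the kinematic space. -/
noncomputable def fibreForm {m : ℕ} (Θ : Corr m [⋀^Fin (m + 2 * m)]→ₗ[ℝ] ℂ) :
    Kin (m + 3) [⋀^Fin m]→ₗ[ℝ] ℂ where
  toFun := fibreCoefficient Θ
  map_update_add' := by
    intro _ v j x y
    have h1 : ((x + y, 0) : Corr m) = (x, 0) + (y, 0) := by simp
    simp only [fibreCoefficient, append_update_left fun z => ((z, 0) : Corr m)]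
    rw [h1, AlternatingMap.map_update_add]
  map_update_smul' := by
    intro _ v j c x
    have h1 : ((c • x, 0) : Corr m) = c • (x, 0) := by simp
    simp only [fibreCoefficient, append_update_left fun z => ((z, 0) : Corr m)]
    rw [h1, AlternatingMap.map_update_smul]
  map_eq_zero_of_eq' := by
    intro v i j hv hij
    refine Θ.map_eq_zero_of_eq _ (i := Fin.castAdd _ i) (j := Fin.castAdd _ j) ?_ ?_
    · simp [hv]
    · simpa using hij


/-! ### The scattering form as a sum over solutions -/

theorem contDiffAt_alternatingMap_apply {V X : Type*} [NormedAddCommGroup V] [NormedSpace ℝ V]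
    [FiniteDimensional ℝ V] [NormedAddCommGroup X] [NormedSpace ℝ X] {ι : Type*} [Fintype ι]
    (β : V [⋀^ι]→ₗ[ℝ] ℂ) {w : ι → X → V} {x : X} (hw : ∀ i, ContDiffAt ℝ ∞ (w i) x) :
    ContDiffAt ℝ ∞ (fun y => β fun i => w i y) x := by
  classical
  let b := Module.finBasis ℝ V
  have h : ∀ y, (β fun i => w i y) = ∑ r : ι → Fin (Module.finrank ℝ V),
      (∏ i, LinearMap.toContinuousLinearMap (b.coord (r i)) (w i y)) • β fun i => b (r i) := by
    intro y
    have h1 : (fun i => w i y) = fun i => ∑ k, b.coord k (w i y) • b k := by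
      funext i
      exact (b.sum_repr (w i y)).symm
    conv_lhs => rw [h1]
    rw [← AlternatingMap.coe_multilinearMap, MultilinearMap.map_sum]
    refine Finset.sum_congr rfl fun r _ => ?_
    rw [MultilinearMap.map_smul_univ]
    rfl
  simp only [h]
  have hr : ∀ r : ι → Fin (Module.finrank ℝ V), ContDiffAt ℝ ∞
      (fun y => ∏ i, LinearMap.toContinuousLinearMap (b.coord (r i)) (w i y)) x := fun r =>
    contDiffAt_prod fun i _ => (ContinuousLinearMap.contDiff _).contDiffAt.comp x (hw i)
  exact ContDiffAt.sum fun r _ => (hr r).smul contDiffAt_const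

/-- The contribution of `q^*[δ̄^{n-3}(τ) ∧ ω^{n-3}]` at a point of the correspondence space, without
the delta functions, as a form on the kinematic space. -/
noncomputable def residueForm {m : ℕ} (y : Corr m) : Kin (m + 3) [⋀^Fin m]→ₗ[ℝ] ℂ :=
  fibreForm ((twistorForm m).compLinearMap (fderiv ℝ (incidenceMap m) y).toLinearMap)

theorem residueForm_apply {m : ℕ} (y : Corr m) (v : Fin m → Kin (m + 3)) :
    residueForm y v = twistorForm m (Fin.append (fun j => fderiv ℝ (incidenceMap m) y (v j, 0))
      fun l => fderiv ℝ (incidenceMap m) y (0, fibreBasis m l)) := by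
  change twistorForm m _ = _
  congr 1
  funext i
  refine Fin.addCases (fun i => ?_) (fun i => ?_) i <;> simp

theorem fibreCoefficient_pulledBackForm {m : ℕ} (ρ : ℂ → ℝ) (ε : ℝ) (y : Corr m)
    (v : Fin m → Kin (m + 3)) :
    fibreCoefficient (pulledBackForm ρ ε y) v =
      (∏ i, ε⁻¹ ^ 2 * ρ ((ε⁻¹ : ℂ) * scatteringMap y.1 y.2 i)) • residueForm y v := by
  unfold pulledBackForm
  rw [wedge_deltaBarForm_eq]
  rfl

theorem contDiffAt_incidenceMap {m : ℕ} {s : Kin (m + 3)} {σ : Fin m → ℂ} (hσ : σ ∈ moduli m) :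
    ContDiffAt ℝ ∞ (incidenceMap m) (s, σ) :=
  (contDiffAt_scatteringMap hσ).prodMk contDiffAt_snd

theorem hasFDerivAt_incidenceMap {m : ℕ} (s : Kin (m + 3)) {σ : Fin m → ℂ} (hσ : σ ∈ moduli m) :
    HasFDerivAt (incidenceMap m) (fderiv ℝ (incidenceMap m) (s, σ)) (s, σ) :=
  ((contDiffAt_incidenceMap hσ).differentiableAt (by simp)).hasFDerivAt

theorem contDiffAt_residueForm {m : ℕ} {s : Kin (m + 3)} {σ : Fin m → ℂ} (hσ : σ ∈ moduli m)
    (v : Fin m → Kin (m + 3)) : ContDiffAt ℝ ∞ (fun y : Corr m => residueForm y v) (s, σ) := by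
  have h1 : ContDiffAt ℝ ∞ (fderiv ℝ (incidenceMap m)) (s, σ) :=
    (contDiffAt_incidenceMap hσ).fderiv_right (by simp)
  simp only [residueForm_apply]
  refine contDiffAt_alternatingMap_apply (twistorForm m) (w := fun i y => Fin.append
    (fun j => fderiv ℝ (incidenceMap m) y (v j, 0))
      (fun l => fderiv ℝ (incidenceMap m) y (0, fibreBasis m l)) i) fun i => ?_
  refine Fin.addCases (fun i => ?_) (fun i => ?_) i
  · simp only [Fin.append_left]
    exact h1.clm_apply contDiffAt_const
  · simp only [Fin.append_right]
    exact h1.clm_apply contDiffAt_const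

/-- By linearity of `τ = E(s, σ)` in `s`, the differential of the incidence map sends the lift of
the Euler vector field to `∑ τ_i ∂/∂τ_i`, which vanishes at solutions. -/
theorem fderiv_incidenceMap_eulerField {m : ℕ} {s : Kin (m + 3)} {σ : Fin m → ℂ}
    (hσ : σ ∈ solutions s) : fderiv ℝ (incidenceMap m) (s, σ) (eulerField s, 0) = 0 := by
  have h1 : HasDerivAt (fun t : ℝ => ((t • s, σ) : Corr m)) (s, 0) 1 := by
    have := (hasDerivAt_id (1 : ℝ)).smul_const s
    rw [one_smul] at this
    exact this.prodMk (hasDerivAt_const _ _)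
  have h2 : HasFDerivAt (incidenceMap m) (fderiv ℝ (incidenceMap m) (s, σ))
      ((1 : ℝ) • s, σ) := by
    rw [one_smul]
    exact hasFDerivAt_incidenceMap s hσ.1
  have h3 := h2.comp_hasDerivAt (1 : ℝ) h1
  have h4 : (incidenceMap m ∘ fun t : ℝ => ((t • s, σ) : Corr m)) = fun _ => (0, σ) := by
    funext t
    simp [incidenceMap, scatteringMap_smul, hσ.2]
  rw [h4] at h3
  exact h3.unique (hasDerivAt_const _ _)

theorem residueForm_eq_zero_of_eulerField {m : ℕ} {s : Kin (m + 3)} {σ : Fin m → ℂ}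
    (hσ : σ ∈ solutions s) {v : Fin m → Kin (m + 3)} {j : Fin m} (hv : v j = eulerField s) :
    residueForm (s, σ) v = 0 := by
  rw [residueForm_apply]
  refine AlternatingMap.map_coord_zero _ (Fin.castAdd _ j) ?_
  rw [Fin.append_left, hv, fderiv_incidenceMap_eulerField hσ]

theorem fderiv_incidenceMap_smul {m : ℕ} (c : ℝ) (s : Kin (m + 3)) {σ : Fin m → ℂ}
    (hσ : σ ∈ moduli m) (v : Kin (m + 3)) (b : Fin m → ℂ) :
    fderiv ℝ (incidenceMap m) (c • s, σ) (c • v, b) =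
      dilation m c (fderiv ℝ (incidenceMap m) (s, σ) (v, b)) := by
  let S : Corr m →L[ℝ] Corr m :=
    (c • ContinuousLinearMap.fst ℝ (Kin (m + 3)) (Fin m → ℂ)).prod
      (ContinuousLinearMap.snd ℝ (Kin (m + 3)) (Fin m → ℂ))
  have h1 : HasFDerivAt (incidenceMap m ∘ S)
      ((fderiv ℝ (incidenceMap m) (c • s, σ)).comp S) (s, σ) :=
    HasFDerivAt.comp (s, σ) (hasFDerivAt_incidenceMap (c • s) hσ) S.hasFDerivAt
  have h2 := (dilation m c).hasFDerivAt.comp (s, σ) (hasFDerivAt_incidenceMap s hσ)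
  have h3 : incidenceMap m ∘ S = dilation m c ∘ incidenceMap m := by
    funext y
    simp [incidenceMap, S, dilation, scatteringMap_smul]
  rw [h3] at h1
  exact DFunLike.congr_fun (h1.unique h2) (v, b)

theorem residueForm_smul {m : ℕ} (c : ℝ) (s : Kin (m + 3)) {σ : Fin m → ℂ}
    (hσ : σ ∈ moduli m) (v : Fin m → Kin (m + 3)) :
    residueForm (c • s, σ) (fun j => c • v j) = c ^ (2 * m) • residueForm (s, σ) v := by
  have h := fun w => DFunLike.congr_fun (twistorForm_dilation m c) w
  rw [residueForm_apply, residueForm_apply, ← AlternatingMap.smul_apply, ← h,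
    AlternatingMap.compLinearMap_apply]
  congr 1
  funext i
  refine Fin.addCases (fun i => ?_) (fun i => ?_) i
  · simpa using fderiv_incidenceMap_smul c s hσ (v i) 0
  · simpa using fderiv_incidenceMap_smul c s hσ 0 (fibreBasis m i)

theorem finrank_fibre (m : ℕ) : Module.finrank ℝ (Fin m → ℂ) = 2 * m := by
  rw [Module.finrank_pi_fintype]
  simp [mul_comm]

theorem realJacobian_smul {m : ℕ} (c : ℝ) (s : Kin (m + 3)) {σ : Fin m → ℂ} (hσ : σ ∈ moduli m) :
    realJacobian (c • s) σ = c ^ (2 * m) * realJacobian s σ := by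
  have h : scatteringMap (c • s) = c • scatteringMap s := by
    funext σ
    rw [scatteringMap_smul]
    rfl
  rw [realJacobian, h, fderiv_const_smul
    ((contDiffAt_scatteringMap_right s hσ).differentiableAt (by simp)), ContinuousLinearMap.det,
    ContinuousLinearMap.toLinearMap_smul, LinearMap.det_smul, finrank_fibre]
  rfl

/-- The summand `f / |det E'| · q^*[⋯]` of the scattering form at a point of the correspondence
space; only its values at solutions matter. -/
noncomputable def localContribution {m : ℕ} (I : HalfIntegrand m) (y : Corr m) :
    Kin (m + 3) [⋀^Fin m]→ₗ[ℝ] ℂ :=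
  ((|realJacobian y.1 y.2|⁻¹ : ℝ) * I.coeff y.1 y.2 : ℂ) • residueForm y

/-- The localization of the scattering form on the solutions of the scattering equations. -/
noncomputable def solutionSum {m : ℕ} (I : HalfIntegrand m) (s : Kin (m + 3)) :
    Kin (m + 3) [⋀^Fin m]→ₗ[ℝ] ℂ :=
  ∑ᶠ σ ∈ solutions s, localContribution I (s, σ)

theorem solutionSum_apply {m : ℕ} (I : HalfIntegrand m) {s : Kin (m + 3)}
    (hs : s ∈ genericLocus m) (v : Fin m → Kin (m + 3)) :
    solutionSum I s v = ∑ᶠ σ ∈ solutions s, localContribution I (s, σ) v := by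
  rw [solutionSum, finsum_mem_eq_finite_toFinset_sum _ (finite_solutions hs),
    finsum_mem_eq_finite_toFinset_sum _ (finite_solutions hs), alternatingMap_sum_apply]

theorem isFibreIntegral_solutionSum {m : ℕ} (I : HalfIntegrand m) {s : Kin (m + 3)}
    (hs : s ∈ genericLocus m) : IsFibreIntegral I s (solutionSum I s) := by
  intro ρ χ hρ hχ v
  let φ : (Fin m → ℂ) → ℝ := fun u => ∏ i, ρ (u i)
  have hφ : Continuous φ :=
    continuous_finsetProd _ fun i _ => hρ.smooth.continuous.comp (continuous_apply i)
  have hφc : HasCompactSupport φ := by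
    refine HasCompactSupport.intro (isCompact_univ_pi fun _ => hρ.hasCompactSupport.isCompact)
      fun u hu => ?_
    simp only [Set.mem_pi, Set.mem_univ, true_imp_iff, not_forall] at hu
    obtain ⟨i, hi⟩ := hu
    exact Finset.prod_eq_zero (Finset.mem_univ i) (image_eq_zero_of_notMem_tsupport hi)
  have hφ1 : ∫ u, φ u = 1 := by
    rw [integral_fintype_prod_volume_eq_pow, hρ.integral_eq_one, one_pow]
  let H : (Fin m → ℂ) → ℂ := fun σ => (χ σ : ℂ) * (I.coeff s σ * residueForm (s, σ) v)
  have hHχ : ∀ σ, χ σ = 0 → H σ = 0 := fun σ h => by simp [H, h]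
  have hsub : tsupport H ⊆ tsupport χ :=
    closure_mono fun σ hσ h => hσ (hHχ σ h)
  have hH : Continuous H := by
    refine continuous_of_tsupport fun σ hσ => ?_
    have hσ' : σ ∈ moduli m := hχ.tsupport_subset (hsub hσ)
    refine (Complex.continuous_ofReal.comp hχ.smooth.continuous).continuousAt.mul
      (ContinuousAt.mul ?_ ?_)
    · exact (I.holomorphic s hs).continuousOn.continuousAt ((isOpen_moduli m).mem_nhds hσ')
    · exact (contDiffAt_residueForm hσ' v).continuousAt.comp
        (f := fun σ => ((s, σ) : Corr m)) (Continuous.prodMk_right s).continuousAt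
  have hHc : HasCompactSupport H := hχ.hasCompactSupport.mono' (subset_closure.trans hsub)
  have hlim := tendsto_integral_rescale_comp volume (isOpen_moduli m) (E := scatteringMap s)
    (fun σ hσ => ((contDiffAt_scatteringMap_right s hσ).of_le (by simp)).contDiffWithinAt)
    (finite_solutions hs) (fun σ => Iff.rfl) (fun σ hσ => realJacobian_ne_zero hs hσ) hH hHc
    (hsub.trans hχ.tsupport_subset) hφ hφc
  have hval : ∑ᶠ a ∈ solutions s,
      (∫ u, φ u) • |(fderiv ℝ (scatteringMap s) a).det|⁻¹ • H a = solutionSum I s v := by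
    rw [solutionSum_apply I hs]
    refine finsum_mem_congr rfl fun σ hσ => ?_
    have hχ1 : χ σ = 1 := (hχ.eventually_eq_one σ hσ).self_of_nhds
    simp only [hφ1, one_smul, H, hχ1, localContribution, AlternatingMap.smul_apply,
      realJacobian, Complex.ofReal_one, one_mul, Complex.real_smul, smul_eq_mul, mul_assoc]
  rw [hval] at hlim
  refine hlim.congr fun ε => ?_
  -- Outside the moduli space the cutoff vanishes, so that the integral extends to all of `ℂ^{n-3}`;
  -- the `n - 3` factors `ε⁻²` make up the normalization in real dimension `2 (n - 3)`.
  rw [regularizedIntegral, setIntegral_eq_integral_of_forall_compl_eq_zero]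
  · refine integral_congr_ae (Eventually.of_forall fun σ => ?_)
    simp only [fibreCoefficient_pulledBackForm, H, φ, finrank_fibre]
    rw [Finset.prod_mul_distrib, Finset.prod_const, Finset.card_univ, Fintype.card_fin, ← pow_mul]
    simp only [Complex.real_smul, Pi.smul_apply, Complex.ofReal_inv]
    ring
  · intro σ hσ
    rw [image_eq_zero_of_notMem_tsupport fun h => hσ (hχ.tsupport_subset h)]
    simp

theorem IsFibreIntegral.unique {m : ℕ} {I : HalfIntegrand m} {s : Kin (m + 3)}
    (hs : s ∈ genericLocus m) {Ω Ω' : Kin (m + 3) [⋀^Fin m]→ₗ[ℝ] ℂ}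
    (h : IsFibreIntegral I s Ω) (h' : IsFibreIntegral I s Ω') : Ω = Ω' := by
  obtain ⟨ρ, hρ⟩ := exists_isMollifier
  obtain ⟨χ, hχ⟩ := exists_isCutoff hs
  ext v
  exact tendsto_nhds_unique (h ρ χ hρ hχ v) (h' ρ χ hρ hχ v)

theorem isFibreIntegral_scatteringForm {m : ℕ} (I : HalfIntegrand m) {s : Kin (m + 3)}
    (hs : s ∈ genericLocus m) : IsFibreIntegral I s (scatteringForm I s) := by
  have h : ∃ Ω, IsFibreIntegral I s Ω := ⟨_, isFibreIntegral_solutionSum I hs⟩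
  rw [scatteringForm, dif_pos h]
  exact h.choose_spec

theorem scatteringForm_apply {m : ℕ} (I : HalfIntegrand m) {s : Kin (m + 3)}
    (hs : s ∈ genericLocus m) (v : Fin m → Kin (m + 3)) :
    scatteringForm I s v = ∑ᶠ σ ∈ solutions s, localContribution I (s, σ) v := by
  rw [← solutionSum_apply I hs, (isFibreIntegral_scatteringForm I hs).unique hs
    (isFibreIntegral_solutionSum I hs)]

theorem contDiffOn_scatteringForm {m : ℕ} (I : HalfIntegrand m) (v : Fin m → Kin (m + 3)) :
    ContDiffOn ℝ ∞ (fun s => scatteringForm I s v) (genericLocus m) := by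
  refine ContDiffOn.congr (fun s hs => ContDiffAt.contDiffWithinAt ?_)
    fun s hs => scatteringForm_apply I hs v
  refine contDiffAt_sum_solutions hs (H := fun y => localContribution I y v) fun σ hσ => ?_
  refine ContDiffAt.mul (ContDiffAt.mul ?_ ?_) (contDiffAt_residueForm hσ.1 v)
  · refine Complex.ofRealCLM.contDiff.contDiffAt.comp (s, σ) ?_
    have hJ := realJacobian_ne_zero hs hσ
    have habs : ContDiffAt ℝ ∞ (fun y : Corr m => |realJacobian y.1 y.2|) (s, σ) :=
      (contDiffAt_realJacobian hσ.1).abs hJ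
    exact habs.inv (abs_ne_zero.2 hJ)
  · exact I.smooth.contDiffAt
      (((isOpen_genericLocus m).prod (isOpen_moduli m)).mem_nhds ⟨hs, hσ.1⟩)

theorem scatteringForm_eq_zero_of_eulerField {m : ℕ} (I : HalfIntegrand m) {s : Kin (m + 3)}
    (hs : s ∈ genericLocus m) {v : Fin m → Kin (m + 3)} {j : Fin m} (hv : v j = eulerField s) :
    scatteringForm I s v = 0 := by
  rw [scatteringForm_apply I hs]
  refine finsum_mem_eq_zero_of_forall_eq_zero fun σ hσ => ?_
  rw [localContribution, AlternatingMap.smul_apply, residueForm_eq_zero_of_eulerField hσ hv,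
    smul_zero]

/-- Under `s ↦ c s` the form `q^*[⋯]` and the real Jacobian both scale with `c ^ (2 (n - 3))`, so
that only the homogeneity of the half-integrand remains. -/
theorem scatteringForm_smul {m : ℕ} {I : HalfIntegrand m} {d : ℤ} (hI : I.IsHomogeneous d)
    {s : Kin (m + 3)} (hs : s ∈ genericLocus m) {c : ℝ} (hc : c ≠ 0) (v : Fin m → Kin (m + 3)) :
    scatteringForm I (c • s) (fun j => c • v j) = ((c ^ d : ℝ) : ℂ) * scatteringForm I s v := by
  rw [scatteringForm_apply I (smul_mem_genericLocus hs hc), scatteringForm_apply I hs,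
    solutions_smul hc, mul_finsum_mem]
  refine finsum_mem_congr rfl fun σ hσ => ?_
  have hpos : 0 < c ^ (2 * m) := by rw [pow_mul]; positivity
  simp only [localContribution, AlternatingMap.smul_apply, smul_eq_mul]
  rw [residueForm_smul c s hσ.1, realJacobian_smul c s hσ.1, hI s hs c hc σ hσ.1, abs_mul,
    abs_of_pos hpos, Complex.real_smul]
  have h1 : ((c ^ (2 * m) : ℝ) : ℂ) ≠ 0 := by exact_mod_cast hpos.ne'
  rw [mul_inv, Complex.ofReal_mul, Complex.ofReal_inv (c ^ (2 * m))]
  field_simp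


/-! ### Descent to the projective space -/

section Projective

variable {V : Type*} [AddCommGroup V] [Module ℝ V]

theorem mem_submodule_mk (s : V) (hs : s ≠ 0) :
    s ∈ (Projectivization.mk ℝ s hs).submodule := by
  rw [Projectivization.submodule_mk]
  exact Submodule.mem_span_singleton_self s

theorem projDeriv_apply_self (s : V) (hs : s ≠ 0) (v : V) :
    projDeriv s hs v ⟨s, mem_submodule_mk s hs⟩ =
      (Projectivization.mk ℝ s hs).submodule.mkQ v := by
  have h : (LinearEquiv.toSpanNonzeroSingleton ℝ V s hs).symm ⟨s, mem_submodule_mk s hs⟩ = 1 := by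
    rw [LinearEquiv.symm_apply_eq]
    exact (LinearEquiv.toSpanNonzeroSingleton_one ℝ V s hs).symm
  change (LinearEquiv.toSpanNonzeroSingleton ℝ V s hs).symm ⟨s, mem_submodule_mk s hs⟩ •
    (Projectivization.mk ℝ s hs).submodule.mkQ v = _
  rw [h, one_smul]

theorem exists_smul_eq_of_mem_submodule_mk {s x : V} {hs : s ≠ 0}
    (hx : x ∈ (Projectivization.mk ℝ s hs).submodule) : ∃ c : ℝ, c • s = x := by
  rw [Projectivization.submodule_mk] at hx
  exact Submodule.mem_span_singleton.1 hx

theorem projDeriv_surjective (s : V) (hs : s ≠ 0) : Function.Surjective (projDeriv s hs) := by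
  intro T
  obtain ⟨v, hv⟩ := (Projectivization.mk ℝ s hs).submodule.mkQ_surjective
    (T ⟨s, mem_submodule_mk s hs⟩)
  refine ⟨v, LinearMap.ext fun x => ?_⟩
  obtain ⟨x, hx⟩ := x
  obtain ⟨c, rfl⟩ := exists_smul_eq_of_mem_submodule_mk hx
  have h : (⟨c • s, hx⟩ : (Projectivization.mk ℝ s hs).submodule) =
      c • ⟨s, mem_submodule_mk s hs⟩ := rfl
  rw [h, map_smul, map_smul, projDeriv_apply_self, hv]

/-- An alternating form that vanishes whenever an argument is `x` does not change when multiples of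
`x` are added to the arguments. -/
theorem alternatingMap_congr_of_sub_mem_span {k : ℕ} (Ω : V [⋀^Fin k]→ₗ[ℝ] ℂ) {x : V}
    (h : ∀ (u : Fin k → V) j, u j = x → Ω u = 0) {v w : Fin k → V}
    (hvw : ∀ j, ∃ c : ℝ, v j - w j = c • x) : Ω v = Ω w := by
  classical
  have key : ∀ S : Finset (Fin k), Ω (S.piecewise v w) = Ω w := by
    intro S
    induction S using Finset.induction_on with
    | empty => simp
    | insert a S ha ih =>
      obtain ⟨c, hc⟩ := hvw a
      have h1 : v a = w a + c • x := by rw [← hc]; abel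
      rw [Finset.piecewise_insert, h1, Ω.map_update_add, Ω.map_update_smul,
        h (Function.update (S.piecewise v w) a x) a (Function.update_self _ _ _),
        smul_zero, add_zero]
      have h2 : S.piecewise v w a = w a := Finset.piecewise_eq_of_notMem _ _ _ ha
      rw [← h2, Function.update_eq_self, ih]
  simpa using key Finset.univ

/-- A family of forms on a subset of `V` which vanish on the Euler vector field and are invariant
under dilations is the pullback of a unique family of forms on the image in the projective space. -/
theorem existsUnique_form_projectivization {k : ℕ} {U : Set V} (Ω : V → V [⋀^Fin k]→ₗ[ℝ] ℂ)
    (h0 : ∀ s ∈ U, ∀ (v : Fin k → V) (j : Fin k), v j = s → Ω s v = 0)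
    (h1 : ∀ s ∈ U, ∀ c : ℝ, c ≠ 0 → ∀ v : Fin k → V, Ω (c • s) (fun j => c • v j) = Ω s v) :
    ∃! η : (p : {p : ℙ ℝ V | ∃ (s : V) (hs : s ≠ 0), s ∈ U ∧ Projectivization.mk ℝ s hs = p}) →
        ProjTangent p.1 [⋀^Fin k]→ₗ[ℝ] ℂ,
      ∀ (s : V) (hs : s ≠ 0) (hg : s ∈ U),
        Ω s = (η ⟨Projectivization.mk ℝ s hs, s, hs, hg, rfl⟩).compLinearMap (projDeriv s hs) := by
  choose lift hlift using fun p : ℙ ℝ V =>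
    p.submodule.mkQ.exists_rightInverse_of_surjective p.submodule.range_mkQ
  choose x hx0 hxU hxp using
    fun p : {p : ℙ ℝ V | ∃ (s : V) (hs : s ≠ 0), s ∈ U ∧ Projectivization.mk ℝ s hs = p} => p.2
  have hxmem : ∀ p, x p ∈ p.1.submodule := fun p => by
    have := mem_submodule_mk (x p) (hx0 p)
    rwa [hxp p] at this
  have key : ∀ (s : V) (hs : s ≠ 0) (y : V) (hy : y ∈ (Projectivization.mk ℝ s hs).submodule),
      s ∈ U → y ∈ U → y ≠ 0 → Ω s = ((Ω y).compLinearMap (lift (Projectivization.mk ℝ s hs) ∘ₗ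
        LinearMap.applyₗ ⟨y, hy⟩)).compLinearMap (projDeriv s hs) := by
    intro s hs y hy hsU hyU hy0
    obtain ⟨c, rfl⟩ := exists_smul_eq_of_mem_submodule_mk hy
    have hc0 : c ≠ 0 := by
      rintro rfl
      exact hy0 (zero_smul ℝ s)
    ext v
    rw [← h1 s hsU c hc0]
    refine alternatingMap_congr_of_sub_mem_span _ (h0 _ hyU) fun j => ?_
    have h2 : projDeriv s hs (v j) ⟨c • s, hy⟩ =
        (Projectivization.mk ℝ s hs).submodule.mkQ (c • v j) := by
      have h3 : (⟨c • s, hy⟩ : (Projectivization.mk ℝ s hs).submodule) =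
          c • ⟨s, mem_submodule_mk s hs⟩ := rfl
      rw [h3, map_smul, projDeriv_apply_self, map_smul]
    have h4 : c • v j - lift _ (projDeriv s hs (v j) ⟨c • s, hy⟩) ∈
        (Projectivization.mk ℝ s hs).submodule := by
      refine (Submodule.Quotient.eq _).1 ?_
      rw [h2]
      exact (LinearMap.congr_fun (hlift (Projectivization.mk ℝ s hs)) _).symm
    obtain ⟨b, hb⟩ := exists_smul_eq_of_mem_submodule_mk h4
    refine ⟨b * c⁻¹, ?_⟩
    rw [smul_smul, inv_mul_cancel_right₀ hc0, hb]
    rfl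
  -- A tangent vector at the line `p`, a map `p → V / p`, is evaluated at the representative `x p`,
  -- and the value is lifted from `V / p` to `V`.
  refine ⟨fun p => (Ω (x p)).compLinearMap (lift p.1 ∘ₗ LinearMap.applyₗ ⟨x p, hxmem p⟩),
    fun s hs hg => key s hs _ _ hg (hxU _) (hx0 _), fun η' hη' => ?_⟩
  funext ⟨_, s, hs, hg, rfl⟩
  exact AlternatingMap.compLinearMap_injective _ (projDeriv_surjective s hs)
    ((hη' s hs hg).symm.trans (key s hs _ _ hg (hxU _) (hx0 _)))

end Projective

end CHY


open CHY
/-- The scattering form `Ω_I`, an `(n-3)`-form with `n = m + 4 ≥ 4`, is projective. -/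
theorem mainTheorem5 (m : ℕ) (I : HalfIntegrand (m + 1)) :
    -- the generic locus is an open cone, on which `Ω_I` is a well-defined smooth form
    IsOpen (genericLocus (m + 1)) ∧
    (∀ s ∈ genericLocus (m + 1), ∀ c : ℝ, c ≠ 0 → c • s ∈ genericLocus (m + 1)) ∧
    (∀ s ∈ genericLocus (m + 1),
      (∃! Ω, IsFibreIntegral I s Ω) ∧ IsFibreIntegral I s (scatteringForm I s)) ∧
    (∀ v, ContDiffOn ℝ ∞ (fun s => scatteringForm I s v) (genericLocus (m + 1))) ∧
    -- `Υ ⌟ Ω_I = 0`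
    (∀ s ∈ genericLocus (m + 1), (scatteringForm I s).curryLeft (eulerField s) = 0) ∧
    -- `Ω_I` has the same degree of homogeneity in the kinematic variables as `I`
    (∀ d : ℤ, I.IsHomogeneous d → ∀ s ∈ genericLocus (m + 1), ∀ c : ℝ, c ≠ 0 →
      (scatteringForm I (c • s)).compLinearMap (c • LinearMap.id) =
        ((c ^ d : ℝ) : ℂ) • scatteringForm I s) ∧
    -- `Ω_I` is the pullback of a unique form on the projectivized kinematic space
    (I.IsHomogeneous 0 →
      ∃! η : (p : projGenericLocus (m + 1)) → ProjTangent p.1 [⋀^Fin (m + 1)]→ₗ[ℝ] ℂ,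
        ∀ (s : Kin (m + 1 + 3)) (hs : s ≠ 0) (hg : s ∈ genericLocus (m + 1)),
          scatteringForm I s =
            (η ⟨Projectivization.mk ℝ s hs, s, hs, hg, rfl⟩).compLinearMap (projDeriv s hs)) := by
  refine ⟨isOpen_genericLocus _, fun s hs c hc => smul_mem_genericLocus hs hc, fun s hs => ?_,
    contDiffOn_scatteringForm I, fun s hs => ?_, fun d hI s hs c hc => ?_, fun hI => ?_⟩
  · have h := isFibreIntegral_scatteringForm I hs
    exact ⟨⟨_, h, fun Ω hΩ => hΩ.unique hs h⟩, h⟩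
  · ext v
    exact scatteringForm_eq_zero_of_eulerField I hs (v := Matrix.vecCons (eulerField s) v) (j := 0)
      rfl
  · ext v
    exact scatteringForm_smul hI hs hc v
  · exact existsUnique_form_projectivization (scatteringForm I)
      (fun s hs v j hv => scatteringForm_eq_zero_of_eulerField I hs hv)
      fun s hs c hc v => by simpa using scatteringForm_smul hI hs hc v
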